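/- Let $d\ge 0$ and $n\ge 2$ be integers. Identify $\mathbb T^d=\mathbb R^d/n\mathbb Z^d$ with $[0,n)^d$ and let $\oplus$ be coordinatewise addition modulo $n$. Let $T\subseteq[0,n)^d$ be such that $[0,1)^d\oplus T=\{[0,1)^d\oplus t: t\in T\}$ is a cube tiling, i.e. a partition of $\mathbb T^d$. For $i\in\{1,\dots,d\}$ let $p_i(T)=\{t_i \bmod 1: t\in T\}\subseteq[0,1)$. Then the sets $p_i(T)$ are finite and $$\sum_{i=1}^d|p_i(T)|\le\frac{n^d-1}{n-1},$$ with equality if and only if $[0,1)^d\oplus T$ is a multipile. Here multipiles are defined as follows. Put $X_i=[0,n)$ and $\Pi_i=\{\pi_t: t\in[0,1)\}\cup\{\{X_i\}\}$ for $i=1,\dots,d$, where $\pi_t=\{[0,1)\oplus t\oplus k: k=0,\dots,n-1\}$. A partition in $\Pi_i$ is non-trivial if it is not $\{X_i\}$. A box is a set $K=K_1\times\cdots\times K_d$ such that each side $K_i$ is a part of some partition in $\Pi_i$. A Keller family is a non-empty family $\mathscr G$ of boxes such that for all different $K,L\in\mathscr G$ there is an $i$ for which $K_i$ and $L_i$ are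 different parts of one partition in $\Pi_i$. A set $W\subseteq\mathbb T^d$ is an $i$-cylinder if, with each of its points, it contains the whole line through that point parallel to the $i$-th axis. For a family $\mathscr G$ of boxes, a direction $i$, and a set $\mathscr V$ of sides, write $\mathscr G|\mathscr V=\{K\in\mathscr G: K_i\in\mathscr V\}$, and $\mathscr G|A=\mathscr G|\{A\}$. Let $C_i(\mathscr G)$ be the set of non-trivial $\pi\in\Pi_i$ such that $\mathscr G|\pi$ (restriction in direction $i$) is a Keller family whose union is an $i$-cylinder. An $i$-pile laminated with respect to a non-trivial $\pi\in\Pi_i$ is a Keller family $\mathscr G$ whose union is an $i$-cylinder and for which $\mathscr G|\pi=\mathscr G$. The multipiles form the smallest class of families of boxes such that 1. $\{K\}$ is a multipile for every box $K$; 2. $\mathscr G$ is a multipile if there are $i$ and a non-trivial $\pi\in\Pi_i$ such that $\mathscr G$ is an $i$-pile laminated with respect to $\pi$; for every $A\in\pi$ the family $\mathscr G|A$ (restriction in direction $i$) is a multipile; and $C_k(\mathscr G|A)\cap C_k(\mathscr G|B)=\emptyset$ for all $k\ne i$ and all different $A,B\in\pi$. -/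

import Mathlib

/-! ### Boxes, Keller families, piles and multipiles

`P i` is a family of partitions of `X i`.  A box `K₁ × ⋯ × K_d` is recorded by the tuple
`K : ∀ i, Set (X i)` of its sides; the subset of the product that it stands for is
`Set.univ.pi K`.  Parts of partitions are non-empty, so this loses nothing. -/

namespace BoxSystem

variable {ι : Type*} {X : ι → Type*}

/-- `K` is a box of the system: every side is a part of some partition in `P i`. -/
def IsBox (P : ∀ i, Set (Set (Set (X i)))) (K : ∀ i, Set (X i)) : Prop :=
  ∀ i, ∃ π ∈ P i, K i ∈ π

/-- The union of a family of boxes, as a subset of the product. -/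
def union (G : Set (∀ i, Set (X i))) : Set (∀ i, X i) :=
  ⋃ K ∈ G, Set.univ.pi K

/-- A Keller family: a non-empty family of boxes such that any two different members have, in
some direction `i`, sides that are different parts of one partition in `P i`. -/
structure IsKellerFamily (P : ∀ i, Set (Set (Set (X i)))) (G : Set (∀ i, Set (X i))) : Prop where
  nonempty : G.Nonempty
  isBox : ∀ K ∈ G, IsBox P K
  keller : ∀ K ∈ G, ∀ L ∈ G, K ≠ L → ∃ i, ∃ π ∈ P i, K i ∈ π ∧ L i ∈ π ∧ K i ≠ L i

/-- The restriction `G|V`: the members of `G` whose `i`-th side belongs to `V`. -/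
def restrict (G : Set (∀ i, Set (X i))) (i : ι) (V : Set (Set (X i))) : Set (∀ i, Set (X i)) :=
  {K ∈ G | K i ∈ V}

/-- `W` contains, with each of its points `x`, the line through `x` in direction `i`. -/
def IsCylinder (i : ι) (W : Set (∀ i, X i)) : Prop :=
  ∀ x ∈ W, ∀ y : ∀ i, X i, (∀ j, j ≠ i → y j = x j) → y ∈ W

/-- A partition of `X i` is non-trivial if it is not `{X i}`. -/
def IsNontrivial {Y : Type*} (π : Set (Set Y)) : Prop := π ≠ {Set.univ}

/-- The family of boxes `G` is a Keller family whose union is an `i`-cylinder. -/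
def IsCylinderSuit (P : ∀ i, Set (Set (Set (X i)))) (i : ι) (G : Set (∀ i, Set (X i))) : Prop :=
  IsKellerFamily P G ∧ IsCylinder i (union G)

/-- `G` is an `i`-pile laminated with respect to the non-trivial partition `π ∈ P i`. -/
structure IsPile (P : ∀ i, Set (Set (Set (X i)))) (i : ι) (π : Set (Set (X i)))
    (G : Set (∀ i, Set (X i))) : Prop where
  mem : π ∈ P i
  nontrivial : IsNontrivial π
  laminated : restrict G i π = G
  suit : IsCylinderSuit P i G

/-- `C_i(G)`: the non-trivial partitions `π ∈ P i` that are hidden in `G`, that is, such that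
`G|π` is a suit for an `i`-cylinder. -/
def hidden (P : ∀ i, Set (Set (Set (X i)))) (i : ι) (G : Set (∀ i, Set (X i))) :
    Set (Set (Set (X i))) :=
  {π ∈ P i | IsNontrivial π ∧ IsCylinderSuit P i (restrict G i π)}

/-- Multipiles. -/
inductive IsMultipile (P : ∀ i, Set (Set (Set (X i)))) : Set (∀ i, Set (X i)) → Prop
  | single (K : ∀ i, Set (X i)) (hK : IsBox P K) : IsMultipile P {K}
  | pile (G : Set (∀ i, Set (X i))) (i : ι) (π : Set (Set (X i)))
      (hG : IsPile P i π G)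
      (hsub : ∀ A ∈ π, IsMultipile P (restrict G i {A}))
      (hdisj : ∀ k, k ≠ i → ∀ A ∈ π, ∀ B ∈ π, A ≠ B →
        hidden P k (restrict G i {A}) ∩ hidden P k (restrict G i {B}) = ∅) :
      IsMultipile P G

end BoxSystem

/-! ### Cube tilings of the torus `[0,n)^d` -/

namespace CubeTiling

/-- The one-dimensional torus `ℝ / nℤ`, identified with `[0,n)`. -/
abbrev Coord (n : ℕ) : Type := Set.Ico (0 : ℝ) (n : ℝ)

/-- Addition modulo `n`: the element of `[0,n)` congruent to `x + y` modulo `n`. -/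
noncomputable def oplus {n : ℕ} (x y : Coord n) : Coord n :=
  ⟨toIcoMod (x.2.1.trans_lt x.2.2) 0 ((x : ℝ) + (y : ℝ)), by
    simpa using toIcoMod_mem_Ico (x.2.1.trans_lt x.2.2) 0 ((x : ℝ) + (y : ℝ))⟩

/-- The unit segment `[0,1)`. -/
def unitSegment (n : ℕ) : Set (Coord n) := {u | (u : ℝ) < 1}

/-- The translate `[0,1) ⊕ t`. -/
noncomputable def segment {n : ℕ} (t : Coord n) : Set (Coord n) :=
  (fun u => oplus u t) '' unitSegment n

/-- The integer `k ∈ {0, …, n - 1}` as a point of `[0,n)`. -/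
def ofFin {n : ℕ} (k : Fin n) : Coord n :=
  ⟨((k : ℕ) : ℝ), by positivity, by exact_mod_cast k.2⟩

/-- The partition `π_t = {[0,1) ⊕ t ⊕ k : k ∈ {0, …, n - 1}}` of `[0,n)`. -/
noncomputable def segmentPartition {n : ℕ} (t : Coord n) : Set (Set (Coord n)) :=
  Set.range fun k : Fin n => segment (oplus t (ofFin k))

/-- The family `{π_t : t ∈ [0,1)} ∪ {{[0,n)}}` of partitions of `[0,n)`, used in each of the `d`
directions. -/
noncomputable def partitions (d n : ℕ) : Fin d → Set (Set (Set (Coord n))) :=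
  fun _ => segmentPartition '' unitSegment n ∪ {{Set.univ}}

/-- The torus `[0,n)^d`. -/
abbrev Torus (d n : ℕ) : Type := Fin d → Coord n

/-- The translate `[0,1)^d ⊕ t` of the unit cube. -/
noncomputable def cube {d n : ℕ} (t : Torus d n) : Set (Torus d n) :=
  (fun (u : Torus d n) i => oplus (u i) (t i)) '' {u | ∀ i, u i ∈ unitSegment n}

/-- `[0,1)^d ⊕ T` is a cube tiling: the cubes `[0,1)^d ⊕ t`, `t ∈ T`, partition the torus. -/
def IsCubeTiling {d n : ℕ} (T : Set (Torus d n)) : Prop :=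
  Setoid.IsPartition (cube '' T)

/-- The tuple of sides of the cube `[0,1)^d ⊕ t`. -/
noncomputable def cubeSides {d n : ℕ} (t : Torus d n) : Fin d → Set (Coord n) :=
  fun i => segment (t i)

/-- The cube `[0,1)^d ⊕ t` is the box with sides `cubeSides t`. -/
theorem pi_cubeSides {d n : ℕ} (t : Torus d n) : Set.univ.pi (cubeSides t) = cube t := by
  ext x
  constructor
  · intro h
    choose u hu hx using fun i => h i (Set.mem_univ i)
    exact ⟨u, hu, funext hx⟩
  · rintro ⟨u, hu, rfl⟩ i _
    exact ⟨u i, hu i, rfl⟩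

/-- The family `[0,1)^d ⊕ T` as a family of boxes. -/
noncomputable def cubeFamily {d n : ℕ} (T : Set (Torus d n)) : Set (Fin d → Set (Coord n)) :=
  cubeSides '' T

/-- `p_i(T) = {t_i mod 1 : t ∈ T}`. -/
noncomputable def residues {d n : ℕ} (i : Fin d) (T : Set (Torus d n)) : Set ℝ :=
  (fun t => Int.fract (t i : ℝ)) '' T

end CubeTiling

/-! The union of a cube tiling is the whole torus, so every partition occurring in direction `i` is
hidden there, and `|p_i(T)|` counts the hidden partitions (`IsCubeTiling.hidden_eq`). Since a tiling
has `n ^ d` cubes and is a Keller family by Keller's theorem, the claim becomes `(n - 1) h + 1 ≤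
|G|` for a finite Keller family `G` with `h` hidden partitions over all directions
(`ncard_hiddenPairs_le`), together with the description of equality.

The inequality is proved by induction on `|G|`. Fix a hidden `π` in direction `i` and a part `A` of
it. Replacing `G|π` by the stretched boxes of `G|A` gives a Keller family `M` with the same union.
Every hidden partition of `G` is `π`, or is hidden in `M`, or is hidden in some layer `G|B` with `B
≠ A` (`hiddenPairs_subset`). The first two kinds rest on independence: parts of two different
partitions have a common non-empty union only if it is everything, so a partition that occurs is
hidden or not according to the union alone (`hidden_transfer`). As `|G|` is `|M|` plus the sizes of
the `n - 1` other layers, the induction hypotheses add up to the bound.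

If equality holds, `M` and all layers are tight, and a partition hidden in a layer occurs in no
other box (`IsTight.of_hidden_restrict`). A hidden `π` with `|G|π|` minimal then has one-box layers,
and the lamination of the multipile `M` carries over to `G`. Conversely, in a multipile the hidden
partitions of the layers are disjoint and, together with `π`, are hidden in the whole, so induction
gives tightness. -/

namespace BoxSystem

/-! ### Independent systems of partitions and hidden partitions. -/

/-- A system of partitions in which every non-trivial partition has `n` parts, and two different
partitions in one direction have no common proper non-empty union of parts. -/
structure IsIndependentSystem {ι : Type*} {X : ι → Type*} (P : ∀ i, Set (Set (Set (X i))))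
    (n : ℕ) : Prop where
  isPartition : ∀ i, ∀ π ∈ P i, Setoid.IsPartition π
  ncard_eq : ∀ i, ∀ π ∈ P i, IsNontrivial π → π.ncard = n
  trivial_mem : ∀ i, {Set.univ} ∈ P i
  sUnion_eq_univ : ∀ i, ∀ π ∈ P i, ∀ ρ ∈ P i, π ≠ ρ → ∀ 𝒜 ⊆ π, ∀ ℬ ⊆ ρ, 𝒜.Nonempty →
    ⋃₀ 𝒜 = ⋃₀ ℬ → ⋃₀ 𝒜 = Set.univ

/-- The sides in direction `i` of those members of `G` that meet the line through `x` in
direction `i`. -/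
def lineSides {ι : Type*} {X : ι → Type*} (G : Set (∀ i, Set (X i))) (i : ι) (x : ∀ i, X i) :
    Set (Set (X i)) :=
  {A | ∃ K ∈ G, (∀ j, j ≠ i → x j ∈ K j) ∧ K i = A}

/-- All hidden partitions of `G`, in all directions. -/
def hiddenPairs {ι : Type*} {X : ι → Type*} (P : ∀ i, Set (Set (Set (X i))))
    (G : Set (∀ i, Set (X i))) : Set (Σ i, Set (Set (X i))) :=
  {p | p.2 ∈ hidden P p.1 G}

/-- The family obtained from `G` by replacing `G|π` by the boxes of `G|A` stretched to the whole
of `X i` in direction `i`. -/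
def merge {ι : Type*} {X : ι → Type*} [DecidableEq ι] (G : Set (∀ i, Set (X i))) (i : ι)
    (π : Set (Set (X i))) (A : Set (X i)) : Set (∀ i, Set (X i)) :=
  {K ∈ G | K i ∉ π} ∪ (fun K => Function.update K i Set.univ) '' restrict G i {A}

section

variable {ι : Type*} {X : ι → Type*} {P : ∀ i, Set (Set (Set (X i)))} {n : ℕ}
  {G G' : Set (∀ i, Set (X i))} {i : ι} {π ρ : Set (Set (X i))} {A B : Set (X i)}

theorem mem_union {x : ∀ i, X i} : x ∈ union G ↔ ∃ K ∈ G, ∀ i, x i ∈ K i := by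
  simp [union]

theorem restrict_subset (G : Set (∀ i, Set (X i))) (i : ι) (V : Set (Set (X i))) :
    restrict G i V ⊆ G := fun _ h => h.1

theorem union_mono (h : G ⊆ G') : union G ⊆ union G' :=
  Set.biUnion_subset_biUnion_left h

theorem IsKellerFamily.mono (hG : IsKellerFamily P G) (h : G' ⊆ G) (hne : G'.Nonempty) :
    IsKellerFamily P G' :=
  ⟨hne, fun K hK => hG.isBox K (h hK), fun K hK L hL => hG.keller K (h hK) L (h hL)⟩

namespace IsIndependentSystem

theorem part_eq (hP : IsIndependentSystem P n) (hπ : π ∈ P i) (hA : A ∈ π) (hB : B ∈ π)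
    {a : X i} (ha : a ∈ A) (hb : a ∈ B) : A = B :=
  ((hP.isPartition i π hπ).2 a).unique ⟨hA, ha⟩ ⟨hB, hb⟩

theorem part_nonempty (hP : IsIndependentSystem P n) (hπ : π ∈ P i) (hA : A ∈ π) :
    A.Nonempty := by
  rw [Set.nonempty_iff_ne_empty]
  rintro rfl
  exact (hP.isPartition i π hπ).1 hA

theorem univ_notMem (hP : IsIndependentSystem P n) (hπ : π ∈ P i) (hn : IsNontrivial π) :
    Set.univ ∉ π := by
  intro h
  apply hn
  ext B
  constructor
  · intro hB
    obtain ⟨b, hb⟩ := hP.part_nonempty hπ hB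
    exact hP.part_eq hπ hB h hb trivial
  · rintro rfl
    exact h

/-- Independence applied to the single part `A`: a common part of two different partitions would be
everything. -/
theorem partition_eq (hP : IsIndependentSystem P n) (hπ : π ∈ P i) (hn : IsNontrivial π)
    (hρ : ρ ∈ P i) (hA : A ∈ π) (hA' : A ∈ ρ) : ρ = π := by
  by_contra hne
  have := hP.sUnion_eq_univ i π hπ ρ hρ (Ne.symm hne) {A} (by simpa) {A} (by simpa)
    (Set.singleton_nonempty A) rfl
  rw [Set.sUnion_singleton] at this
  exact hP.univ_notMem hπ hn (this ▸ hA)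

theorem finite (hP : IsIndependentSystem P n) (hn : 2 ≤ n) (hπ : π ∈ P i)
    (hπn : IsNontrivial π) : π.Finite :=
  Set.finite_of_ncard_pos (by rw [hP.ncard_eq i π hπ hπn]; omega)

theorem exists_ne_part (hP : IsIndependentSystem P n) (hn : 2 ≤ n) (hπ : π ∈ P i)
    (hπn : IsNontrivial π) (A : Set (X i)) : ∃ B ∈ π, B ≠ A :=
  Set.exists_ne_of_one_lt_ncard (by rw [hP.ncard_eq i π hπ hπn]; omega) A

theorem box_nonempty (hP : IsIndependentSystem P n) {K : ∀ i, Set (X i)} (hK : IsBox P K) :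
    ∃ x : ∀ i, X i, ∀ i, x i ∈ K i := by
  choose π hπ hKπ using hK
  choose x hx using fun i => hP.part_nonempty (hπ i) (hKπ i)
  exact ⟨x, hx⟩

/-- The members of a Keller family that meet one line have sides from one partition. -/
theorem side_mem (hP : IsIndependentSystem P n) (hG : IsKellerFamily P G)
    {K L : ∀ i, Set (X i)} (hK : K ∈ G) (hL : L ∈ G) {x : ∀ i, X i}
    (hx : ∀ j, j ≠ i → x j ∈ K j) (hy : ∀ j, j ≠ i → x j ∈ L j)
    (hπ : π ∈ P i) (hn : IsNontrivial π) (hKπ : K i ∈ π) : L i ∈ π := by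
  by_cases hKL : K = L
  · exact hKL ▸ hKπ
  -- In a direction other than `i` both sides contain `x k`, so only direction `i` can separate `K`
  -- from `L`.
  · obtain ⟨k, ρ, hρ, h1, h2, h3⟩ := hG.keller K hK L hL hKL
    by_cases hk : k = i
    · subst hk
      exact hP.partition_eq hπ hn hρ hKπ h1 ▸ h2
    · exact absurd (hP.part_eq hρ h1 h2 (hx k hk) (hy k hk)) h3

/-- It suffices to ask that the lines over boxes of `G|π` lie in `union G`: by `side_mem`, any box
of `G` met by such a line is already in `G|π`. -/
theorem mem_hidden_iff (hP : IsIndependentSystem P n) (hG : IsKellerFamily P G) :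
    π ∈ hidden P i G ↔ π ∈ P i ∧ IsNontrivial π ∧ (∃ K ∈ G, K i ∈ π) ∧
      ∀ K ∈ G, K i ∈ π → ∀ x : ∀ i, X i, (∀ j, j ≠ i → x j ∈ K j) → x ∈ union G := by
  constructor
  · rintro ⟨hπ, hn, hs, hc⟩
    refine ⟨hπ, hn, ?_, ?_⟩
    · obtain ⟨K, hK⟩ := hs.nonempty
      exact ⟨K, hK.1, hK.2⟩
    · intro K hK hKπ x hx
      classical
      obtain ⟨a, ha⟩ := hP.part_nonempty hπ hKπ
      refine union_mono (restrict_subset G i π) (hc (Function.update x i a) ?_ x ?_)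
      · refine mem_union.2 ⟨K, ⟨hK, hKπ⟩, fun j => ?_⟩
        by_cases hj : j = i
        · subst hj; simpa
        · simpa [hj] using hx j hj
      · intro j hj; simp [hj]
  · rintro ⟨hπ, hn, ⟨K, hK, hKπ⟩, hc⟩
    refine ⟨hπ, hn, hG.mono (restrict_subset G i π) ⟨K, hK, hKπ⟩, ?_⟩
    intro x hx y hy
    obtain ⟨M, hM, hxM⟩ := mem_union.1 hx
    have hyM : ∀ j, j ≠ i → y j ∈ M j := fun j hj => hy j hj ▸ hxM j
    obtain ⟨L, hL, hyL⟩ := mem_union.1 (hc M hM.1 hM.2 y hyM)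
    exact mem_union.2 ⟨L, ⟨hL, hP.side_mem hG hM.1 hL hyM (fun j _ => hyL j) hπ hn hM.2⟩, hyL⟩

theorem nonempty_of_mem_hidden (h : π ∈ hidden P i G) : ∃ K ∈ G, K i ∈ π := by
  obtain ⟨K, hK⟩ := h.2.2.1.nonempty
  exact ⟨K, hK.1, hK.2⟩

theorem mem_sUnion_lineSides [DecidableEq ι] {x : ∀ i, X i} {a : X i} :
    a ∈ ⋃₀ lineSides G i x ↔ Function.update x i a ∈ union G := by
  rw [mem_union]
  constructor
  · rintro ⟨_, ⟨K, hK, hx, rfl⟩, ha⟩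
    refine ⟨K, hK, fun j => ?_⟩
    by_cases hj : j = i
    · subst hj; simpa
    · simpa [hj] using hx j hj
  · rintro ⟨K, hK, h⟩
    refine ⟨K i, ⟨K, hK, fun j hj => ?_, rfl⟩, ?_⟩
    · simpa [hj] using h j
    · simpa using h i

/-- Whether a partition is hidden depends only on its presence and on the union. -/
theorem hidden_transfer (hP : IsIndependentSystem P n) (hG : IsKellerFamily P G)
    (hG' : IsKellerFamily P G') (hU : union G = union G') (hπ : π ∈ hidden P i G)
    (hK : ∃ K ∈ G', K i ∈ π) : π ∈ hidden P i G' := by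
  classical
  obtain ⟨hπP, hn, -, hc⟩ := (hP.mem_hidden_iff hG).1 hπ
  refine (hP.mem_hidden_iff hG').2 ⟨hπP, hn, hK, fun K hK hKπ y hy => ?_⟩
  obtain ⟨a, ha⟩ := hP.part_nonempty hπP hKπ
  have hyK : a ∈ ⋃₀ lineSides G' i y := ⟨K i, ⟨K, hK, hy, rfl⟩, ha⟩
  have hS : ⋃₀ lineSides G' i y = ⋃₀ lineSides G i y := by
    ext b
    rw [mem_sUnion_lineSides, mem_sUnion_lineSides, hU]
  obtain ⟨_, ⟨L, hL, hyL, rfl⟩, haL⟩ := hS ▸ hyK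
  obtain ⟨ρ, hρ, hLρ⟩ := hG.isBox L hL i
  by_cases hρπ : ρ = π
  · exact hU ▸ hc L hL (hρπ ▸ hLρ) y hyL
  -- The section of the union by this line is a union of parts of `π` (seen in `G'`) and of parts of
  -- `ρ ≠ π` (seen in `G`), hence the whole line. A trivial `ρ` fills the line at once.
  · have key : y i ∈ ⋃₀ lineSides G' i y := by
      by_cases hρn : IsNontrivial ρ
      · rw [hP.sUnion_eq_univ i π hπP ρ hρ (Ne.symm hρπ) (lineSides G' i y) ?_
          (lineSides G i y) ?_ ⟨K i, K, hK, hy, rfl⟩ hS]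
        · trivial
        · rintro _ ⟨M, hM, hyM, rfl⟩
          exact hP.side_mem hG' hK hM hy hyM hπP hn hKπ
        · rintro _ ⟨M, hM, hyM, rfl⟩
          exact hP.side_mem hG hL hM hyL hyM hρ hρn hLρ
      · rw [hS]
        refine ⟨L i, ⟨L, hL, hyL, rfl⟩, ?_⟩
        rw [not_not.1 hρn] at hLρ
        rw [Set.mem_singleton_iff.1 hLρ]
        trivial
    rw [mem_sUnion_lineSides, Function.update_eq_self] at key
    exact key

/-- A line meeting a box of `G|π` is filled by `G|π`, so it crosses every layer `G|B`. -/
theorem exists_mem_restrict (hP : IsIndependentSystem P n) (hG : IsKellerFamily P G)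
    (hπ : π ∈ hidden P i G) (hB : B ∈ π) {K : ∀ i, Set (X i)} (hK : K ∈ G) (hKπ : K i ∈ π)
    {x : ∀ i, X i} (hx : ∀ j, j ≠ i → x j ∈ K j) (hxB : x i ∈ B) :
    ∃ L ∈ restrict G i {B}, ∀ j, x j ∈ L j := by
  obtain ⟨hπP, hn, -, hc⟩ := (hP.mem_hidden_iff hG).1 hπ
  obtain ⟨L, hL, hxL⟩ := mem_union.1 (hc K hK hKπ x hx)
  have := hP.side_mem hG hK hL hx (fun j _ => hxL j) hπP hn hKπ
  exact ⟨L, ⟨hL, hP.part_eq hπP this hB (hxL i) hxB⟩, hxL⟩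

theorem restrict_nonempty (hP : IsIndependentSystem P n) (hG : IsKellerFamily P G)
    (hπ : π ∈ hidden P i G) (hB : B ∈ π) : (restrict G i {B}).Nonempty := by
  classical
  obtain ⟨K, hK, hKπ⟩ := nonempty_of_mem_hidden hπ
  obtain ⟨x, hx⟩ := hP.box_nonempty (hG.isBox K hK)
  obtain ⟨b, hb⟩ := hP.part_nonempty hπ.1 hB
  obtain ⟨L, hL, -⟩ := hP.exists_mem_restrict hG hπ hB hK hKπ (x := Function.update x i b)
    (fun j hj => by simpa [hj] using hx j) (by simpa)
  exact ⟨L, hL⟩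

theorem restrict_isKellerFamily (hP : IsIndependentSystem P n) (hG : IsKellerFamily P G)
    (hπ : π ∈ hidden P i G) (hB : B ∈ π) : IsKellerFamily P (restrict G i {B}) :=
  hG.mono (restrict_subset _ _ _) (hP.restrict_nonempty hG hπ hB)

/-- Boxes of `G|B` cover only `B` in direction `i`, so no non-empty subfamily is an `i`-cylinder. -/
theorem hidden_restrict_eq_empty (hP : IsIndependentSystem P n) (hB : B ≠ Set.univ) :
    hidden P i (restrict G i {B}) = ∅ := by
  classical
  rw [Set.eq_empty_iff_forall_notMem]
  rintro ρ ⟨hρ, hn, hs, hc⟩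
  obtain ⟨K, hK⟩ := hs.nonempty
  obtain ⟨x, hx⟩ := hP.box_nonempty (hs.isBox K hK)
  obtain ⟨b, hb⟩ := (Set.ne_univ_iff_exists_notMem B).1 hB
  obtain ⟨L, hL, hxL⟩ := mem_union.1 (hc x (mem_union.2 ⟨K, hK, hx⟩) (Function.update x i b)
    (fun j hj => by simp [hj]))
  have h1 := hxL i
  rw [show L i = B from hL.1.2, Function.update_self] at h1
  exact hb h1

/-- Hidden partitions of `G` in another direction that do not occur outside `G|π` are hidden in
`G|B` as soon as they occur there. -/
theorem hidden_restrict_of_notMem (hP : IsIndependentSystem P n) (hG : IsKellerFamily P G)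
    (hπ : π ∈ hidden P i G) (hB : B ∈ π) {k : ι} (hk : k ≠ i) {σ : Set (Set (X k))}
    (hσ : σ ∈ hidden P k G) (hR : ∀ K ∈ G, K k ∈ σ → K i ∈ π)
    (hK : ∃ K ∈ restrict G i {B}, K k ∈ σ) : σ ∈ hidden P k (restrict G i {B}) := by
  obtain ⟨hσP, hn, -, hc⟩ := (hP.mem_hidden_iff hG).1 hσ
  refine (hP.mem_hidden_iff (hP.restrict_isKellerFamily hG hπ hB)).2 ⟨hσP, hn, hK, ?_⟩
  intro K hK hKσ x hx
  obtain ⟨L, hL, hxL⟩ := mem_union.1 (hc K hK.1 hKσ x hx)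
  have hLσ := hP.side_mem hG hK.1 hL hx (fun j _ => hxL j) hσP hn hKσ
  refine mem_union.2 ⟨L, ⟨hL, ?_⟩, hxL⟩
  refine hP.part_eq hπ.1 (hR L hL hLσ) hB (hxL i) ?_
  have h2 := hx i hk.symm
  rwa [show K i = B from hK.2] at h2

/-! ### Merging the layers of a hidden partition. -/

section Merge

variable [DecidableEq ι]

/-- Stretching destroys only separations in direction `i`, and none is needed: boxes of `G|A` share
that side, and a side outside `π` never lies in one partition with `A`. -/
theorem merge_isKellerFamily (hP : IsIndependentSystem P n) (hG : IsKellerFamily P G)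
    (hπ : π ∈ hidden P i G) (hA : A ∈ π) : IsKellerFamily P (merge G i π A) := by
  have cross : ∀ K ∈ G, K i ∉ π → ∀ L ∈ restrict G i {A},
      ∃ k, k ≠ i ∧ ∃ ρ ∈ P k, K k ∈ ρ ∧ L k ∈ ρ ∧ K k ≠ L k := by
    intro K hK hKπ L hL
    have hLπ : L i ∈ π := (show L i = A from hL.2) ▸ hA
    obtain ⟨k, ρ, hρ, h1, h2, h3⟩ := hG.keller K hK L hL.1 (by rintro rfl; exact hKπ hLπ)
    refine ⟨k, ?_, ρ, hρ, h1, h2, h3⟩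
    rintro rfl
    exact hKπ (hP.partition_eq hπ.1 hπ.2.1 hρ hLπ h2 ▸ h1)
  refine ⟨?_, ?_, ?_⟩
  · obtain ⟨K, hK⟩ := hP.restrict_nonempty hG hπ hA
    exact ⟨_, Or.inr ⟨K, hK, rfl⟩⟩
  · rintro K (hK | ⟨K, hK, rfl⟩)
    · exact hG.isBox K hK.1
    · intro j
      by_cases hj : j = i
      · subst hj
        exact ⟨_, hP.trivial_mem j, by simp⟩
      · simpa [hj] using hG.isBox K hK.1 j
  · rintro K (hK | ⟨K, hK, rfl⟩) L (hL | ⟨L, hL, rfl⟩) hKL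
    · exact hG.keller K hK.1 L hL.1 hKL
    · obtain ⟨k, hk, ρ, hρ, h⟩ := cross K hK.1 hK.2 L hL
      exact ⟨k, ρ, hρ, by simpa [hk] using h⟩
    · obtain ⟨k, hk, ρ, hρ, h1, h2, h3⟩ := cross L hL.1 hL.2 K hK
      exact ⟨k, ρ, hρ, by simpa [hk] using ⟨h2, h1, h3.symm⟩⟩
    · obtain ⟨k, ρ, hρ, h1, h2, h3⟩ := hG.keller K hK.1 L hL.1 (by rintro rfl; exact hKL rfl)
      have hk : k ≠ i := by
        rintro rfl
        exact h3 ((show K k = A from hK.2).trans (show L k = A from hL.2).symm)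
      exact ⟨k, ρ, hρ, by simpa [hk] using ⟨h1, h2, h3⟩⟩

theorem union_merge (hP : IsIndependentSystem P n) (hG : IsKellerFamily P G)
    (hπ : π ∈ hidden P i G) (hA : A ∈ π) : union (merge G i π A) = union G := by
  obtain ⟨hπP, hn, -, hc⟩ := (hP.mem_hidden_iff hG).1 hπ
  ext x
  constructor
  · intro hx
    obtain ⟨K, hK | ⟨K, hK, rfl⟩, hxK⟩ := mem_union.1 hx
    · exact mem_union.2 ⟨K, hK.1, hxK⟩
    · refine hc K hK.1 ((show K i = A from hK.2) ▸ hA) x fun j hj => ?_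
      simpa [hj] using hxK j
  · intro hx
    obtain ⟨K, hK, hxK⟩ := mem_union.1 hx
    by_cases hKπ : K i ∈ π
    · obtain ⟨a, ha⟩ := hP.part_nonempty hπP hA
      obtain ⟨L, hL, hxL⟩ := hP.exists_mem_restrict hG hπ hA hK hKπ (x := Function.update x i a)
        (fun j hj => by simpa [hj] using hxK j) (by simpa)
      refine mem_union.2 ⟨_, Or.inr ⟨L, hL, rfl⟩, fun j => ?_⟩
      by_cases hj : j = i
      · subst hj; simp
      · simpa [hj] using hxL j
    · exact mem_union.2 ⟨K, Or.inl ⟨hK, hKπ⟩, hxK⟩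

theorem injOn_update (G : Set (∀ i, Set (X i))) (i : ι) (A B : Set (X i)) :
    Set.InjOn (fun K : ∀ i, Set (X i) => Function.update K i B) (restrict G i {A}) := by
  intro K hK L hL h
  ext1 j
  by_cases hj : j = i
  · subst hj
    exact (show K j = A from hK.2).trans (show L j = A from hL.2).symm
  · simpa [hj] using congrFun h j

theorem ncard_merge (hP : IsIndependentSystem P n) (hG : IsKellerFamily P G) (hfin : G.Finite)
    (hπ : π ∈ hidden P i G) (hA : A ∈ π) :
    (merge G i π A).ncard = {K ∈ G | K i ∉ π}.ncard + (restrict G i {A}).ncard := by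
  rw [merge, Set.ncard_union_eq _ (hfin.subset fun _ h => h.1)
    ((hfin.subset (restrict_subset _ _ _)).image _), (injOn_update G i A _).ncard_image]
  rw [Set.disjoint_left]
  rintro _ hK ⟨L, hL, rfl⟩
  have hLπ : L i ∈ π := (show L i = A from hL.2) ▸ hA
  -- If the stretched copy of `L` were in `G` outside `G|π`, it could be separated from `L` only in
  -- direction `i`, which would force its side there into `π`.
  obtain ⟨k, ρ, hρ, h1, h2, h3⟩ := hG.keller _ hK.1 L hL.1 (fun h => hK.2 (by rw [h]; exact hLπ))
  have hk : k = i := by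
    by_contra hk
    simp [hk] at h3
  subst hk
  exact hK.2 (hP.partition_eq hπ.1 hπ.2.1 hρ hLπ h2 ▸ h1)

end Merge

/-! ### Counting boxes and hidden partitions. -/

theorem ncard_restrict (hfin : G.Finite) (hfπ : π.Finite) :
    (restrict G i π).ncard = ∑ B ∈ hfπ.toFinset, (restrict G i {B}).ncard := by
  classical
  have hf : ∀ V, (restrict G i V).Finite := fun V => hfin.subset (restrict_subset _ _ _)
  have : restrict G i π = ((hfπ.toFinset.biUnion fun B => (hf {B}).toFinset : Finset _) :
      Set (∀ i, Set (X i))) := by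
    ext K
    simp [restrict]
  rw [this, Set.ncard_coe_finset, Finset.card_biUnion]
  · exact Finset.sum_congr rfl fun B _ => (Set.ncard_eq_toFinset_card _ _).symm
  · intro B _ C _ hBC
    refine Finset.disjoint_left.2 fun K hK hK' => ?_
    simp [restrict] at hK hK'
    exact hBC (hK.2.symm.trans hK'.2)

theorem ncard_eq_add (hfin : G.Finite) (hfπ : π.Finite) : G.ncard = {K ∈ G | K i ∉ π}.ncard +
      ∑ B ∈ hfπ.toFinset, (restrict G i {B}).ncard := by
  rw [← ncard_restrict hfin hfπ, ← Set.ncard_union_eq _ (hfin.subset fun _ h => h.1)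
    (hfin.subset (restrict_subset _ _ _))]
  · congr 1
    ext K
    simp [restrict]
    tauto
  · rw [Set.disjoint_left]
    exact fun K hK hK' => hK.2 hK'.2

/-- For fixed `i`, choosing a box of `G` in which a hidden partition occurs is injective, because a
side determines its non-trivial partition. -/
theorem finite_hiddenPairs [Finite ι] (hP : IsIndependentSystem P n) (hfin : G.Finite) :
    (hiddenPairs P G).Finite := by
  classical
  have : ∀ (i : ι), (hidden P i G).Finite := by
    intro i
    have h : ∀ π ∈ hidden P i G, ∃ K ∈ G, K i ∈ π := fun π hπ => nonempty_of_mem_hidden hπ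
    choose! f hf hf' using h
    refine Set.Finite.of_finite_image (hfin.subset (Set.image_subset_iff.2 hf)) ?_
    intro π hπ ρ hρ hfe
    exact (hP.partition_eq hπ.1 hπ.2.1 hρ.1 (hf' π hπ) (hfe ▸ hf' ρ hρ)).symm
  have h2 : hiddenPairs P G = ⋃ i, Sigma.mk i '' hidden P i G := by
    ext ⟨i, π⟩
    simp only [hiddenPairs, Set.mem_ofPred_eq, Set.mem_iUnion, Set.mem_image]
    constructor
    · exact fun h => ⟨i, π, h, rfl⟩
    · rintro ⟨j, ρ, h, heq⟩
      cases heq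
      exact h
  rw [h2]
  exact Set.finite_iUnion fun i => (this i).image _

end IsIndependentSystem

end

theorem ncard_le_sum_of_subset_biUnion {α β : Type*} (I : Finset β) {S : Set α} {f : β → Set α}
    (hf : ∀ b ∈ I, (f b).Finite) (hS : S ⊆ ⋃ b ∈ I, f b) :
    S.ncard ≤ ∑ b ∈ I, (f b).ncard := by
  classical
  refine (Set.ncard_le_ncard hS (I.finite_toSet.biUnion hf)).trans ?_
  clear hS
  induction I using Finset.induction_on with
  | empty => simp
  | insert a I ha ih =>
    rw [Finset.sum_insert ha, Finset.set_biUnion_insert]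
    exact (Set.ncard_union_le _ _).trans
      (Nat.add_le_add_left (ih fun b hb => hf b (Finset.mem_insert_of_mem hb)) _)

/-- A cover that is tight in cardinality is a partition. -/
theorem mem_and_notMem_of_sum_ncard_le {α β : Type*} {I : Finset β} {S : Set α} {f : β → Set α}
    (hf : ∀ b ∈ I, (f b).Finite) (hS : S ⊆ ⋃ b ∈ I, f b) (hc : ∑ b ∈ I, (f b).ncard ≤ S.ncard)
    {a : β} (ha : a ∈ I) {x : α} (hx : x ∈ f a) : x ∈ S ∧ ∀ b ∈ I, b ≠ a → x ∉ f b := by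
  classical
  by_contra hcon
  have hcon' : x ∈ S → ∃ b ∈ I, b ≠ a ∧ x ∈ f b := by
    intro hxS
    by_contra hno
    exact hcon ⟨hxS, fun b hb hba hxb => hno ⟨b, hb, hba, hxb⟩⟩
  -- Otherwise `x` can be deleted from `f a`: the sets still cover `S`, but their sizes add up to
  -- less than `S.ncard`.
  have hlt : ∑ b ∈ I, (Function.update f a (f a \ {x}) b).ncard < ∑ b ∈ I, (f b).ncard := by
    refine Finset.sum_lt_sum (fun b hb => ?_) ⟨a, ha, ?_⟩
    · by_cases hba : b = a
      · subst hba
        rw [Function.update_self]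
        exact Set.ncard_le_ncard Set.sdiff_subset (hf b hb)
      · rw [Function.update_of_ne hba]
    · rw [Function.update_self]
      exact Set.ncard_sdiff_singleton_lt_of_mem hx (hf a ha)
  refine absurd ((ncard_le_sum_of_subset_biUnion I (f := Function.update f a (f a \ {x}))
    ?_ ?_).trans_lt hlt) (not_lt.2 hc)
  · intro b hb
    by_cases hba : b = a
    · subst hba
      rw [Function.update_self]
      exact (hf b hb).subset Set.sdiff_subset
    · rw [Function.update_of_ne hba]
      exact hf b hb
  · intro y hy
    have key : ∃ b ∈ I, (b ≠ a ∨ y ≠ x) ∧ y ∈ f b := by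
      by_cases hyx : y = x
      · subst hyx
        obtain ⟨b, hb, hba, hyb⟩ := hcon' hy
        exact ⟨b, hb, Or.inl hba, hyb⟩
      · obtain ⟨b, hb, hyb⟩ := Set.mem_iUnion₂.1 (hS hy)
        exact ⟨b, hb, Or.inr hyx, hyb⟩
    obtain ⟨b, hb, hne, hyb⟩ := key
    refine Set.mem_iUnion₂.2 ⟨b, hb, ?_⟩
    by_cases hba : b = a
    · subst hba
      rw [Function.update_self]
      exact ⟨hyb, by simpa using hne⟩
    · rwa [Function.update_of_ne hba]

/-! ### The inequality for Keller families. -/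

section

variable {ι : Type*} {X : ι → Type*} {P : ∀ i, Set (Set (Set (X i)))} {n : ℕ}
  {G G' : Set (∀ i, Set (X i))} {i : ι} {π ρ : Set (Set (X i))} {A B : Set (X i)}

open Classical in
/-- The pieces, one for each `B ∈ π`, that cover the hidden partitions of `G`. -/
noncomputable def hiddenPiece (P : ∀ i, Set (Set (Set (X i)))) (G : Set (∀ i, Set (X i))) (i : ι)
    (π : Set (Set (X i))) (A B : Set (X i)) : Set (Σ i, Set (Set (X i))) :=
  if B = A then insert ⟨i, π⟩ (hiddenPairs P (merge G i π A))
  else hiddenPairs P (restrict G i {B})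

namespace IsIndependentSystem

theorem occurs_merge [DecidableEq ι] {k : ι} {σ : Set (Set (X k))} (hσ : ∃ K ∈ G, K k ∈ σ ∧
    (K i ∉ π ∨ (K i = A ∧ k ≠ i))) : ∃ K ∈ merge G i π A, K k ∈ σ := by
  obtain ⟨K, hK, hKσ, hKi | ⟨hKi, hk⟩⟩ := hσ
  · exact ⟨K, Or.inl ⟨hK, hKi⟩, hKσ⟩
  · exact ⟨_, Or.inr ⟨K, ⟨hK, hKi⟩, rfl⟩, by simpa [hk] using hKσ⟩

/-- If a hidden `σ` still occurs after merging, it is hidden there because the union is unchanged.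
If not, it occurs only inside `G|π`; in direction `i` this makes it `π`, and in another direction it
avoids `G|A` and is hidden in each layer where it occurs. -/
theorem hiddenPairs_subset (hP : IsIndependentSystem P n) (hG : IsKellerFamily P G)
    (hπ : π ∈ hidden P i G) (hA : A ∈ π) (hfπ : π.Finite) :
    hiddenPairs P G ⊆ ⋃ B ∈ hfπ.toFinset, hiddenPiece P G i π A B := by
  classical
  rintro ⟨k, σ⟩ hσ
  change σ ∈ hidden P k G at hσ
  simp only [Set.mem_iUnion₂, Set.Finite.mem_toFinset]
  by_cases hm : ∃ K ∈ merge G i π A, K k ∈ σ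
  · refine ⟨A, hA, ?_⟩
    rw [hiddenPiece, if_pos rfl]
    exact Or.inr (hP.hidden_transfer hG (hP.merge_isKellerFamily hG hπ hA)
      (hP.union_merge hG hπ hA).symm hσ (by convert hm))
  have hm' : ∀ K ∈ G, K k ∈ σ → K i ∈ π ∧ (K i = A → k = i) := by
    intro K hK hKσ
    by_contra hcon
    exact hm (occurs_merge ⟨K, hK, hKσ, by tauto⟩)
  obtain ⟨K, hK, hKσ⟩ := nonempty_of_mem_hidden hσ
  obtain ⟨h1, h2⟩ := hm' K hK hKσ
  by_cases hk : k = i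
  · subst hk
    refine ⟨A, hA, ?_⟩
    rw [hiddenPiece, if_pos rfl, hP.partition_eq hσ.1 hσ.2.1 hπ.1 hKσ h1]
    exact Or.inl rfl
  · refine ⟨K i, h1, ?_⟩
    rw [hiddenPiece, if_neg (fun h => hk (h2 h))]
    exact hP.hidden_restrict_of_notMem hG hπ h1 hk hσ (fun L hL hLσ => (hm' L hL hLσ).1)
      ⟨K, ⟨hK, rfl⟩, hKσ⟩

theorem ncard_restrict_pos (hP : IsIndependentSystem P n) (hG : IsKellerFamily P G)
    (hfin : G.Finite) (hπ : π ∈ hidden P i G) (hB : B ∈ π) : 0 < (restrict G i {B}).ncard :=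
  (Set.ncard_pos (hfin.subset (restrict_subset _ _ _))).2 (hP.restrict_nonempty hG hπ hB)

theorem ncard_lt [DecidableEq ι] (hP : IsIndependentSystem P n) (hn : 2 ≤ n)
    (hG : IsKellerFamily P G) (hfin : G.Finite) (hπ : π ∈ hidden P i G) (hA : A ∈ π) :
    (merge G i π A).ncard < G.ncard ∧ (restrict G i {A}).ncard < G.ncard := by
  have hfπ := hP.finite hn hπ.1 hπ.2.1
  obtain ⟨B, hB, hBA⟩ := hP.exists_ne_part hn hπ.1 hπ.2.1 A
  have h1 := hP.ncard_restrict_pos hG hfin hπ hB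
  have h2 := ncard_eq_add hfin hfπ (G := G)
  have h3 := hP.ncard_merge hG hfin hπ hA
  have h4 : (restrict G i {A}).ncard + (restrict G i {B}).ncard ≤
      ∑ B ∈ hfπ.toFinset, (restrict G i {B}).ncard := by
    classical
    rw [← Finset.sum_pair (f := fun B => (restrict G i {B}).ncard) hBA.symm]
    refine Finset.sum_le_sum_of_subset fun C hC => ?_
    rcases Finset.mem_insert.1 hC with rfl | hC
    · simpa
    · rw [Finset.mem_singleton.1 hC]; simpa
  omega

theorem finite_merge [DecidableEq ι] (hfin : G.Finite) : (merge G i π A).Finite :=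
  (hfin.subset fun _ h => h.1).union ((hfin.subset (restrict_subset _ _ _)).image _)

theorem finite_hiddenPiece [Finite ι] (hP : IsIndependentSystem P n) (hfin : G.Finite) :
    (hiddenPiece P G i π A B).Finite := by
  classical
  rw [hiddenPiece]
  split_ifs
  · convert (hP.finite_hiddenPairs (finite_merge (i := i) (π := π) (A := A) hfin)).insert ⟨i, π⟩
  · exact hP.finite_hiddenPairs (hfin.subset (restrict_subset _ _ _))

open Classical in
/-- The numbers of boxes attached to the pieces add up. -/
theorem sum_piece_ncard (hP : IsIndependentSystem P n) (hG : IsKellerFamily P G)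
    (hfin : G.Finite) (hπ : π ∈ hidden P i G) (hA : A ∈ π) (hfπ : π.Finite) :
    ∑ B ∈ hfπ.toFinset, (if B = A then (merge G i π A).ncard else (restrict G i {B}).ncard)
      = G.ncard := by
  have hA' : A ∈ hfπ.toFinset := by simpa
  rw [ncard_eq_add hfin hfπ, ← Finset.add_sum_erase _ _ hA', ← Finset.add_sum_erase _ _ hA',
    if_pos rfl, hP.ncard_merge hG hfin hπ hA, add_assoc]
  congr 2
  exact Finset.sum_congr rfl fun B hB => if_neg (Finset.ne_of_mem_erase hB)

-- The extra `n - 1` pays for `π` itself, which is counted in the piece of `A`. The bound for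
-- smaller families is a hypothesis so that the estimate serves both the induction and the equality
-- case.
open Classical in
theorem ncard_hiddenPiece_le [Finite ι] (hP : IsIndependentSystem P n) (hG : IsKellerFamily P G)
    (hfin : G.Finite) (hn : 2 ≤ n) (hπ : π ∈ hidden P i G) (hA : A ∈ π) (hB : B ∈ π)
    (ih : ∀ G' : Set (∀ i, Set (X i)), G'.ncard < G.ncard → IsKellerFamily P G' → G'.Finite →
      (n - 1) * (hiddenPairs P G').ncard + 1 ≤ G'.ncard) :
    (n - 1) * (hiddenPiece P G i π A B).ncard + 1 ≤
      (if B = A then (merge G i π A).ncard else (restrict G i {B}).ncard) +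
        if B = A then n - 1 else 0 := by
  rw [hiddenPiece]
  split_ifs with h
  · have h1 := ih _ (hP.ncard_lt hn hG hfin hπ hA).1 (hP.merge_isKellerFamily hG hπ hA)
      (finite_merge hfin)
    have h2 := Nat.mul_le_mul_left (n - 1)
      (Set.ncard_insert_le (⟨i, π⟩ : Σ i, Set (Set (X i))) (hiddenPairs P (merge G i π A)))
    rw [mul_add_one] at h2
    omega
  · exact ih _ (hP.ncard_lt hn hG hfin hπ hB).2 (hP.restrict_isKellerFamily hG hπ hB)
      (hfin.subset (restrict_subset _ _ _))

theorem ncard_hiddenPairs_le [Finite ι] (hP : IsIndependentSystem P n) (hn : 2 ≤ n)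
    (hG : IsKellerFamily P G) (hfin : G.Finite) :
    (n - 1) * (hiddenPairs P G).ncard + 1 ≤ G.ncard := by
  classical
  induction hc : G.ncard using Nat.strong_induction_on generalizing G with
  | _ c ih =>
    subst hc
    rcases (hiddenPairs P G).eq_empty_or_nonempty with he | ⟨⟨i, π⟩, hπ⟩
    · rw [he, Set.ncard_empty, mul_zero, zero_add]
      exact (Set.ncard_pos hfin).2 hG.nonempty
    change π ∈ hidden P i G at hπ
    have hfπ := hP.finite hn hπ.1 hπ.2.1
    obtain ⟨A, hA, -⟩ := hP.exists_ne_part hn hπ.1 hπ.2.1 ∅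
    have hA' : A ∈ hfπ.toFinset := by simpa
    have h1 := ncard_le_sum_of_subset_biUnion hfπ.toFinset
      (fun B _ => hP.finite_hiddenPiece hfin) (hP.hiddenPairs_subset hG hπ hA hfπ)
    have h2 := Finset.sum_le_sum fun B (hB : B ∈ hfπ.toFinset) => hP.ncard_hiddenPiece_le hG hfin
      hn hπ hA (by simpa using hB) fun G' hlt hG' hf' => ih _ hlt hG' hf' rfl
    -- Over the `n` parts the left side collects `n` ones, against `|G| + (n - 1)` on the right; one
    -- is left over.
    rw [Finset.sum_add_distrib, Finset.sum_add_distrib, ← Finset.mul_sum,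
      hP.sum_piece_ncard hG hfin hπ hA hfπ, Finset.sum_ite_eq_of_mem' _ _ _ hA',
      Finset.sum_const, ← Set.ncard_eq_toFinset_card _ hfπ, hP.ncard_eq i π hπ.1 hπ.2.1] at h2
    have h3 := Nat.mul_le_mul_left (n - 1) h1
    simp at h2
    omega

end IsIndependentSystem

/-! ### Tight families are multipiles. -/

open IsIndependentSystem

/-- `G` attains the bound of `ncard_hiddenPairs_le`. -/
def IsTight (P : ∀ i, Set (Set (Set (X i)))) (n : ℕ) (G : Set (∀ i, Set (X i))) : Prop :=
  (n - 1) * (hiddenPairs P G).ncard + 1 = G.ncard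

-- Without slack in the total, there is none in the covering by pieces nor in the estimate for any
-- single piece.
open Classical in
theorem IsTight.hiddenPiece_ncard [Finite ι] (hP : IsIndependentSystem P n) (hn : 2 ≤ n)
    (hG : IsKellerFamily P G) (hfin : G.Finite) (ht : IsTight P n G) (hπ : π ∈ hidden P i G)
    (hA : A ∈ π) (hfπ : π.Finite) :
    (∑ B ∈ hfπ.toFinset, (hiddenPiece P G i π A B).ncard ≤ (hiddenPairs P G).ncard) ∧
    ∀ B ∈ π, (n - 1) * (hiddenPiece P G i π A B).ncard + 1 =
      (if B = A then (merge G i π A).ncard else (restrict G i {B}).ncard) +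
        if B = A then n - 1 else 0 := by
  have hA' : A ∈ hfπ.toFinset := by simpa
  have h1 := ncard_le_sum_of_subset_biUnion hfπ.toFinset
    (fun B _ => hP.finite_hiddenPiece hfin) (hP.hiddenPairs_subset hG hπ hA hfπ)
  have h3 := Nat.mul_le_mul_left (n - 1) h1
  have h0 := fun B (hB : B ∈ hfπ.toFinset) => hP.ncard_hiddenPiece_le hG hfin
    hn hπ hA (by simpa using hB) fun G' _ hG' hf' => hP.ncard_hiddenPairs_le hn hG' hf'
  have h2 := Finset.sum_le_sum h0
  have hsum : ∑ B ∈ hfπ.toFinset, ((if B = A then (merge G i π A).ncard else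
      (restrict G i {B}).ncard) + if B = A then n - 1 else 0) = G.ncard + (n - 1) := by
    rw [Finset.sum_add_distrib, hP.sum_piece_ncard hG hfin hπ hA hfπ,
      Finset.sum_ite_eq_of_mem' _ _ _ hA']
  have hsum' : ∑ B ∈ hfπ.toFinset, ((n - 1) * (hiddenPiece P G i π A B).ncard + 1) =
      (n - 1) * ∑ B ∈ hfπ.toFinset, (hiddenPiece P G i π A B).ncard + n := by
    rw [Finset.sum_add_distrib, ← Finset.mul_sum, Finset.sum_const,
      ← Set.ncard_eq_toFinset_card _ hfπ, hP.ncard_eq i π hπ.1 hπ.2.1]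
    simp
  rw [IsTight] at ht
  constructor
  · refine Nat.le_of_mul_le_mul_left (c := n - 1) ?_ (by omega)
    omega
  · intro B hB
    refine (Finset.sum_eq_sum_iff_of_le h0).1 ?_ B (by simpa)
    omega

open Classical in
theorem IsTight.tight_merge [Finite ι] (hP : IsIndependentSystem P n) (hn : 2 ≤ n)
    (hG : IsKellerFamily P G) (hfin : G.Finite) (ht : IsTight P n G) (hπ : π ∈ hidden P i G)
    (hA : A ∈ π) : IsTight P n (merge G i π A) := by
  have h := (ht.hiddenPiece_ncard hP hn hG hfin hπ hA (hP.finite hn hπ.1 hπ.2.1)).2 A hA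
  have h1 := hP.ncard_hiddenPairs_le hn (hP.merge_isKellerFamily hG hπ hA) (finite_merge hfin)
  simp only [hiddenPiece, if_true] at h
  have h2 := Nat.mul_le_mul_left (n - 1)
      (Set.ncard_insert_le (⟨i, π⟩ : Σ i, Set (Set (X i))) (hiddenPairs P (merge G i π A)))
  rw [mul_add_one] at h2
  rw [IsTight]
  omega

/-- Merging along another part `A ≠ B` makes the layer of `B` one of the pieces. -/
theorem IsTight.tight_restrict [Finite ι] (hP : IsIndependentSystem P n) (hn : 2 ≤ n)
    (hG : IsKellerFamily P G) (hfin : G.Finite) (ht : IsTight P n G) (hπ : π ∈ hidden P i G)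
    (hB : B ∈ π) : IsTight P n (restrict G i {B}) := by
  obtain ⟨A, hA, hAB⟩ := hP.exists_ne_part hn hπ.1 hπ.2.1 B
  have h := (ht.hiddenPiece_ncard hP hn hG hfin hπ hA (hP.finite hn hπ.1 hπ.2.1)).2 B hB
  rw [hiddenPiece, if_neg hAB.symm, if_neg hAB.symm, if_neg hAB.symm] at h
  exact h

/-- In the extremal case the hidden partitions of `G|B` are hidden in `G` and occur neither
outside `G|π` nor in another `G|A`. -/
theorem IsTight.of_hidden_restrict [Finite ι] (hP : IsIndependentSystem P n) (hn : 2 ≤ n)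
    (hG : IsKellerFamily P G) (hfin : G.Finite) (ht : IsTight P n G) (hπ : π ∈ hidden P i G)
    (hB : B ∈ π) {k : ι} {σ : Set (Set (X k))} (hσ : σ ∈ hidden P k (restrict G i {B})) :
    k ≠ i ∧ σ ∈ hidden P k G ∧ ∀ K ∈ G, K k ∈ σ → K i = B := by
  classical
  have hk : k ≠ i := by
    rintro rfl
    rw [hP.hidden_restrict_eq_empty (fun h => hP.univ_notMem hπ.1 hπ.2.1 (h ▸ hB))] at hσ
    exact hσ
  have hfπ := hP.finite hn hπ.1 hπ.2.1
  have key : ∀ A ∈ π, A ≠ B → σ ∈ hidden P k G ∧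
      (⟨k, σ⟩ : Σ i, Set (Set (X i))) ∉ hiddenPiece P G i π A A := by
    intro A hA hAB
    have hmem : (⟨k, σ⟩ : Σ i, Set (Set (X i))) ∈ hiddenPiece P G i π A B := by
      rw [hiddenPiece, if_neg hAB.symm]
      exact hσ
    have h := mem_and_notMem_of_sum_ncard_le (fun B _ => hP.finite_hiddenPiece hfin)
      (hP.hiddenPairs_subset hG hπ hA hfπ) (ht.hiddenPiece_ncard hP hn hG hfin hπ hA hfπ).1
      (hfπ.mem_toFinset.2 hB) hmem
    exact ⟨h.1, h.2 A (hfπ.mem_toFinset.2 hA) hAB⟩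
  -- If `σ` survived merging along `A`, it would be hidden in the merged family and so lie in two
  -- pieces of an exact cover. Letting `A` run through all parts other than `B` confines `σ` to
  -- `G|B`.
  have key2 : ∀ A ∈ π, A ≠ B → ∀ K ∈ G, K k ∈ σ → K i ∈ π ∧ K i ≠ A := by
    intro A hA hAB K hK hKσ
    by_contra hcon
    obtain ⟨h1, h2⟩ := key A hA hAB
    rw [hiddenPiece, if_pos rfl] at h2
    refine h2 (Or.inr (hP.hidden_transfer hG (hP.merge_isKellerFamily hG hπ hA)
      (hP.union_merge hG hπ hA).symm h1 (occurs_merge ⟨K, hK, hKσ, by tauto⟩)))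
  obtain ⟨A, hA, hAB⟩ := hP.exists_ne_part hn hπ.1 hπ.2.1 B
  refine ⟨hk, (key A hA hAB).1, fun K hK hKσ => ?_⟩
  by_contra hKB
  have h1 := (key2 A hA hAB K hK hKσ).1
  exact (key2 (K i) h1 hKB K hK hKσ).2 rfl

theorem IsTight.exists_hidden [Finite ι] (ht : IsTight P n G) (h1 : 1 < G.ncard) :
    ∃ i, ∃ π, π ∈ hidden P i G := by
  rw [IsTight] at ht
  rcases (hiddenPairs P G).eq_empty_or_nonempty with he | ⟨⟨i, π⟩, hπ⟩
  · rw [he, Set.ncard_empty] at ht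
    omega
  · exact ⟨i, π, hπ⟩

theorem isMultipile_of_ncard_eq_one (hG : IsKellerFamily P G) (h : G.ncard = 1) :
    IsMultipile P G := by
  obtain ⟨K, rfl⟩ := Set.ncard_eq_one.1 h
  exact IsMultipile.single K (hG.isBox K rfl)

theorem IsPile.mem_hidden (h : IsPile P i π G) : π ∈ hidden P i G :=
  ⟨h.mem, h.nontrivial, h.laminated.symm ▸ h.suit⟩

theorem IsTight.isMultipile [Finite ι] (hP : IsIndependentSystem P n) (hn : 2 ≤ n)
    (hG : IsKellerFamily P G) (hfin : G.Finite) (ht : IsTight P n G) : IsMultipile P G := by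
  classical
  induction hc : G.ncard using Nat.strong_induction_on generalizing G with
  | _ c ih =>
    subst hc
    have hpos := (Set.ncard_pos hfin).2 hG.nonempty
    rcases (show G.ncard = 1 ∨ 1 < G.ncard by omega) with h1 | h1
    · exact isMultipile_of_ncard_eq_one hG h1
    suffices hpile : ∃ i π, IsPile P i π G by
      obtain ⟨i, π, hpile⟩ := hpile
      have hπ := hpile.mem_hidden
      refine IsMultipile.pile G i π hpile (fun A hA => ?_) ?_
      · exact ih _ (hP.ncard_lt hn hG hfin hπ hA).2 (hP.restrict_isKellerFamily hG hπ hA)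
          (hfin.subset (restrict_subset _ _ _)) (ht.tight_restrict hP hn hG hfin hπ hA) rfl
      · intro k _ A hA B hB hAB
        rw [Set.eq_empty_iff_forall_notMem]
        rintro σ ⟨hσA, hσB⟩
        obtain ⟨K, hK, hKσ⟩ := nonempty_of_mem_hidden hσA
        have := (ht.of_hidden_restrict hP hn hG hfin hπ hB hσB).2.2 K hK.1 hKσ
        exact hAB ((show K i = A from hK.2).symm.trans this)
    -- Minimality of `|G|π|` forces one-box layers: a larger layer, being tight, would hide some `σ`
    -- occurring only in that layer, so `G|σ` would be strictly smaller than `G|π`.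
    obtain ⟨⟨i, π⟩, hπ, hmin⟩ : ∃ p ∈ hiddenPairs P G, ∀ q ∈ hiddenPairs P G,
        (restrict G p.1 p.2).ncard ≤ (restrict G q.1 q.2).ncard := by
      obtain ⟨i, π, hπ⟩ := ht.exists_hidden h1
      exact (hP.finite_hiddenPairs hfin).exists_minimalFor (fun p => (restrict G p.1 p.2).ncard)
        _ ⟨⟨i, π⟩, hπ⟩ |>.imp fun p hp => ⟨hp.1, fun q hq => by
          rcases le_total (restrict G p.1 p.2).ncard (restrict G q.1 q.2).ncard with h | h
          · exact h
          · exact hp.2 hq h⟩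
    change π ∈ hidden P i G at hπ
    have hsingle : ∀ A ∈ π, (restrict G i {A}).ncard = 1 := by
      intro A hA
      have hpos := hP.ncard_restrict_pos hG hfin hπ hA
      by_contra hne
      obtain ⟨k, σ, hσ⟩ := (ht.tight_restrict hP hn hG hfin hπ hA).exists_hidden (by omega)
      obtain ⟨-, hσG, hσA⟩ := ht.of_hidden_restrict hP hn hG hfin hπ hA hσ
      obtain ⟨B, hB, hBA⟩ := hP.exists_ne_part hn hπ.1 hπ.2.1 A
      obtain ⟨L, hL⟩ := hP.restrict_nonempty hG hπ hB
      have hLB : L i = B := hL.2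
      refine absurd (hmin ⟨k, σ⟩ hσG) (not_le.2 (Set.ncard_lt_ncard ?_
        (hfin.subset (restrict_subset _ _ _))))
      refine ⟨fun K hK => ⟨hK.1, (hσA K hK.1 hK.2).symm ▸ hA⟩, fun hsub => ?_⟩
      have := hsub (show L ∈ restrict G i π from ⟨hL.1, hLB.symm ▸ hB⟩)
      exact hBA (hLB.symm.trans (hσA L hL.1 this.2))
    obtain ⟨A, hA, -⟩ := hP.exists_ne_part hn hπ.1 hπ.2.1 ∅
    obtain ⟨K, hK⟩ := Set.ncard_eq_one.1 (hsingle A hA)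
    have hKA : K ∈ restrict G i {A} := hK ▸ rfl
    have hmul := ih _ (hP.ncard_lt hn hG hfin hπ hA).1 (hP.merge_isKellerFamily hG hπ hA)
      (finite_merge hfin) (ht.tight_merge hP hn hG hfin hπ hA) rfl
    generalize hM : merge G i π A = M at hmul
    have hKM : Function.update K i Set.univ ∈ M := hM ▸ Or.inr ⟨K, hKA, rfl⟩
    cases hmul with
    | single K' hK' =>
      have hcard := hP.ncard_merge hG hfin hπ hA
      rw [hM, hsingle A hA, Set.ncard_singleton, eq_comm, Nat.add_eq_right,
        Set.ncard_eq_zero (hfin.subset fun _ h => h.1)] at hcard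
      have hlam : restrict G i π = G := by
        refine (restrict_subset _ _ _).antisymm fun L hL => ⟨hL, ?_⟩
        by_contra hLπ
        exact (Set.ext_iff.1 hcard L).1 ⟨hL, hLπ⟩
      exact ⟨i, π, hπ.1, hπ.2.1, hlam, hlam ▸ hπ.2.2⟩
    | pile _ k τ hpile _ _ =>
      have hlamM : ∀ L ∈ M, L k ∈ τ := fun L hL =>
        (hpile.laminated.symm ▸ hL : L ∈ restrict M k τ).2
      -- The stretched box has the full side in direction `i`, which is no part of a non-trivial
      -- partition.
      have hk : k ≠ i := by
        rintro rfl
        have := hlamM _ hKM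
        rw [Function.update_self] at this
        exact hP.univ_notMem hpile.mem hpile.nontrivial this
      have hKτ : K k ∈ τ := by simpa [hk] using hlamM _ hKM
      -- One-box layers of an `i`-cylinder have equal sides in every direction other than `i`:
      -- moving a point of `L` within `L k` and then along `i` must land in the only box of the
      -- other layer.
      have sub : ∀ L ∈ G, L i ∈ π → ∀ L' ∈ G, L' i ∈ π → L k ⊆ L' k := by
        intro L hL hLπ L' hL' hLπ' a ha
        obtain ⟨x, hx⟩ := hP.box_nonempty (hG.isBox L hL)
        obtain ⟨b, hb⟩ := hP.part_nonempty hπ.1 hLπ'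
        obtain ⟨L'', hL'', hx''⟩ := hP.exists_mem_restrict hG hπ hLπ' hL hLπ
          (x := Function.update (Function.update x k a) i b) (fun j hj => by
            rw [Function.update_of_ne hj]
            by_cases hjk : j = k
            · subst hjk; simpa
            · simpa [hjk] using hx j) (by simpa)
        obtain ⟨N, hN⟩ := Set.ncard_eq_one.1 (hsingle _ hLπ')
        have e1 : L'' = N := by rw [hN] at hL''; exact hL''
        have e2 : L' = N := by
          have : L' ∈ restrict G i {L' i} := ⟨hL', rfl⟩
          rw [hN] at this; exact this
        have := hx'' k
        rw [e1, ← e2] at this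
        simpa [hk] using this
      have hlam : restrict G k τ = G := by
        refine (restrict_subset _ _ _).antisymm fun L hL => ⟨hL, ?_⟩
        by_cases hLπ : L i ∈ π
        · have hKπ : K i ∈ π := (show K i = A from hKA.2).symm ▸ hA
          rwa [(sub L hL hLπ K hKA.1 hKπ).antisymm (sub K hKA.1 hKπ L hL hLπ)]
        · exact hlamM L (hM ▸ Or.inl ⟨hL, hLπ⟩)
      exact ⟨k, τ, hpile.mem, hpile.nontrivial, hlam, hG, by
        rw [← hP.union_merge hG hπ hA, hM]; exact hpile.suit.2⟩

/-! ### Multipiles are tight. -/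

theorem IsMultipile.isKellerFamily (h : IsMultipile P G) : IsKellerFamily P G := by
  cases h with
  | single K hK =>
    refine ⟨Set.singleton_nonempty K, ?_, ?_⟩
    · rintro _ rfl
      exact hK
    · rintro _ rfl _ rfl h
      exact absurd rfl h
  | pile _ i π hpile _ _ => exact hpile.suit.1

/-- In a pile the hidden partitions of a layer are hidden in the whole. -/
theorem IsPile.hidden_subset (hP : IsIndependentSystem P n) (hpile : IsPile P i π G)
    (hA : A ∈ π) {k : ι} : hidden P k (restrict G i {A}) ⊆ hidden P k G := by
  classical
  intro σ hσ
  have hπ := hpile.mem_hidden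
  have hG := hpile.suit.1
  have hk : k ≠ i := by
    rintro rfl
    rw [hP.hidden_restrict_eq_empty (fun h => hP.univ_notMem hπ.1 hπ.2.1 (h ▸ hA))] at hσ
    exact hσ
  have hM := hP.merge_isKellerFamily hG hπ hA
  -- In a pile the merged family is just the stretched layer `G|A`, where `σ` clearly stays hidden;
  -- since its union is that of `G`, `hidden_transfer` applies.
  have hσM : σ ∈ hidden P k (merge G i π A) := by
    obtain ⟨hσP, hσn, ⟨K, hK, hKσ⟩, hc⟩ :=
      (hP.mem_hidden_iff (hP.restrict_isKellerFamily hG hπ hA)).1 hσ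
    refine (hP.mem_hidden_iff hM).2 ⟨hσP, hσn, ⟨_, Or.inr ⟨K, hK, rfl⟩, by simpa [hk]⟩, ?_⟩
    rintro _ (hL | ⟨L, hL, rfl⟩) hLσ x hx
    · exact absurd (hpile.laminated.symm ▸ hL.1 : _ ∈ restrict G i π).2 hL.2
    · obtain ⟨a, ha⟩ := hP.part_nonempty hπ.1 hA
      obtain ⟨N, hN, hxN⟩ := mem_union.1 (hc L hL (by simpa [hk] using hLσ)
        (Function.update x i a) fun j hj => by
          by_cases hji : j = i
          · subst hji; simpa [show L j = A from hL.2]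
          · simpa [hji] using hx j hj)
      refine mem_union.2 ⟨_, Or.inr ⟨N, hN, rfl⟩, fun j => ?_⟩
      by_cases hji : j = i
      · subst hji; simp
      · simpa [hji] using hxN j
  obtain ⟨K, hK, hKσ⟩ := nonempty_of_mem_hidden hσ
  exact hP.hidden_transfer hM hG (hP.union_merge hG hπ hA) hσM ⟨K, hK.1, hKσ⟩

/-- Only the inequality opposite to `ncard_hiddenPairs_le` is needed, hence only enough hidden
partitions: `π` and those of the layers, which are pairwise disjoint. -/
theorem IsMultipile.isTight [Finite ι] (hP : IsIndependentSystem P n) (hn : 2 ≤ n)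
    (h : IsMultipile P G) (hfin : G.Finite) : IsTight P n G := by
  induction h with
  | single K hK =>
    have := hP.ncard_hiddenPairs_le hn (IsMultipile.single K hK).isKellerFamily hfin
    rw [Set.ncard_singleton] at this
    rw [IsTight, Set.ncard_singleton]
    omega
  | pile G i π hpile hsub hdisj ih =>
    classical
    have hπ := hpile.mem_hidden
    have hG := hpile.suit.1
    have hfπ := hP.finite hn hπ.1 hπ.2.1
    have hempty : ∀ A ∈ π, hidden P i (restrict G i {A}) = ∅ := fun A hA =>
      hP.hidden_restrict_eq_empty (fun h => hP.univ_notMem hπ.1 hπ.2.1 (h ▸ hA))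
    have hf : ∀ V, (hiddenPairs P (restrict G i V)).Finite := fun V =>
      hP.finite_hiddenPairs (hfin.subset (restrict_subset _ _ _))
    have hle := hP.ncard_hiddenPairs_le hn hG hfin
    have hsubset : insert ⟨i, π⟩ (⋃ A ∈ hfπ.toFinset, hiddenPairs P (restrict G i {A})) ⊆
        hiddenPairs P G := by
      refine Set.insert_subset hπ (Set.iUnion₂_subset fun A hA => ?_)
      rintro ⟨k, σ⟩ hσ
      exact hpile.hidden_subset hP (hfπ.mem_toFinset.1 hA) hσ
    have hcard : (⋃ A ∈ hfπ.toFinset, hiddenPairs P (restrict G i {A})).ncard =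
        ∑ A ∈ hfπ.toFinset, (hiddenPairs P (restrict G i {A})).ncard := by
      have : (⋃ A ∈ hfπ.toFinset, hiddenPairs P (restrict G i {A})) =
          ((hfπ.toFinset.biUnion fun A => (hf {A}).toFinset : Finset _) : Set _) := by
        ext; simp
      rw [this, Set.ncard_coe_finset, Finset.card_biUnion]
      · exact Finset.sum_congr rfl fun B _ => (Set.ncard_eq_toFinset_card _ _).symm
      · intro A hA B hB hAB
        refine Finset.disjoint_left.2 ?_
        rintro ⟨k, σ⟩ h1 h2
        rw [Set.Finite.mem_toFinset] at h1 h2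
        have hA' := hfπ.mem_toFinset.1 hA
        by_cases hk : k = i
        · subst hk
          exact (Set.ext_iff.1 (hempty A hA') σ).1 h1
        · exact (Set.ext_iff.1 (hdisj k hk A hA' B (hfπ.mem_toFinset.1 hB) hAB) σ).1 ⟨h1, h2⟩
    have h1 := Set.ncard_le_ncard hsubset (hP.finite_hiddenPairs hfin)
    rw [Set.ncard_insert_of_notMem ?_ 
      ((hP.finite_hiddenPairs hfin).subset ((Set.subset_insert _ _).trans hsubset)),
      hcard] at h1
    · have h2 : ∑ A ∈ hfπ.toFinset, ((n - 1) * (hiddenPairs P (restrict G i {A})).ncard + 1) =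
          ∑ A ∈ hfπ.toFinset, (restrict G i {A}).ncard :=
        Finset.sum_congr rfl fun A hA =>
          ih A (hfπ.mem_toFinset.1 hA) (hfin.subset (restrict_subset _ _ _))
      rw [← ncard_restrict hfin hfπ, hpile.laminated, Finset.sum_add_distrib, ← Finset.mul_sum,
        Finset.sum_const, ← Set.ncard_eq_toFinset_card _ hfπ, hP.ncard_eq i π hπ.1 hπ.2.1] at h2
      have h3 := Nat.mul_le_mul_left (n - 1) h1
      rw [mul_add_one] at h3
      rw [IsTight]
      simp only [smul_eq_mul, mul_one] at h2
      omega
    · simp only [Set.mem_iUnion₂, not_exists]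
      intro A hA h
      exact (Set.ext_iff.1 (hempty A (hfπ.mem_toFinset.1 hA)) π).1 h

end

end BoxSystem

/-! ### Unit segments on the circle of length `n`. -/

namespace CubeTiling

section

variable {n : ℕ} [NeZero n]

theorem natCast_pos_real (n : ℕ) [NeZero n] : (0 : ℝ) < n := by
  exact_mod_cast Nat.pos_of_ne_zero (NeZero.ne n)

/-- The class of a real number modulo `n`. -/
noncomputable def pt (n : ℕ) [NeZero n] (y : ℝ) : Coord n :=
  ⟨toIcoMod (natCast_pos_real n) 0 y, by
    simpa only [zero_add] using toIcoMod_mem_Ico (natCast_pos_real n) 0 y⟩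

theorem oplus_eq_pt (x y : Coord n) : oplus x y = pt n (x + y) := rfl

@[simp]
theorem pt_coe (x : Coord n) : pt n (x : ℝ) = x :=
  Subtype.ext ((toIcoMod_eq_self _).2 (by simp))

theorem exists_coe_pt (y : ℝ) : ∃ k : ℤ, (pt n y : ℝ) = y + k * n := by
  refine ⟨-toIcoDiv (natCast_pos_real n) 0 y, ?_⟩
  simp only [pt, toIcoMod, zsmul_eq_mul]
  push_cast
  ring

theorem pt_eq_pt_iff {y z : ℝ} : pt n y = pt n z ↔ ∃ k : ℤ, z = y + k * n := by
  rw [pt, pt, Subtype.mk.injEq, toIcoMod_eq_toIcoMod]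
  simp only [zsmul_eq_mul, sub_eq_iff_eq_add']

theorem fract_pt (y : ℝ) : Int.fract (pt n y : ℝ) = Int.fract y := by
  obtain ⟨k, hk⟩ := exists_coe_pt (n := n) y
  rw [hk, show y + k * n = y + ((k * n : ℤ) : ℝ) by push_cast; rfl, Int.fract_add_intCast]

theorem pt_mem_segment_pt_iff {y z : ℝ} :
    pt n y ∈ segment (pt n z) ↔ ∃ k : ℤ, z + k * n ≤ y ∧ y < z + k * n + 1 := by
  have h1 : (1 : ℝ) ≤ n := by exact_mod_cast Nat.one_le_iff_ne_zero.2 (NeZero.ne n)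
  constructor
  · rintro ⟨u, hu, h⟩
    change (u : ℝ) < 1 at hu
    obtain ⟨k, hk⟩ := pt_eq_pt_iff.1 h
    obtain ⟨m, hm⟩ := exists_coe_pt (n := n) z
    have h0 := u.2.1
    refine ⟨m + k, ?_, ?_⟩ <;> push_cast <;> linarith
  · rintro ⟨k, h0, h1'⟩
    have hu : y - (z + k * n) ∈ Set.Ico (0 : ℝ) n := ⟨by linarith, by linarith⟩
    obtain ⟨m, hm⟩ := exists_coe_pt (n := n) z
    refine ⟨⟨y - (z + k * n), hu⟩, show y - (z + k * n) < 1 by linarith,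
      pt_eq_pt_iff.2 ⟨k - m, ?_⟩⟩
    rw [hm]
    push_cast
    ring

theorem pt_mem_segment_pt_of_le {y z : ℝ} (h : z ≤ y) (h' : y < z + 1) :
    pt n y ∈ segment (pt n z) :=
  pt_mem_segment_pt_iff.2 ⟨0, by simpa, by simpa⟩

theorem self_mem_segment (x : Coord n) : x ∈ segment x := by
  have := pt_mem_segment_pt_of_le (n := n) (le_refl (x : ℝ)) (by linarith)
  rwa [pt_coe] at this

/-- Each starting point lies in the other segment, so the windings add up to a multiple of `n` in
`(-2, 0]`, which is `0`. For `n = 1` every segment is the circle. -/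
theorem segment_injective (hn : 2 ≤ n) : Function.Injective (segment (n := n)) := by
  intro x y h
  have hx : x ∈ segment y := h ▸ self_mem_segment x
  have hy : y ∈ segment x := h ▸ self_mem_segment y
  rw [← pt_coe x, ← pt_coe y] at hx hy ⊢
  rw [pt_mem_segment_pt_iff] at hx hy
  obtain ⟨k, hk1, hk2⟩ := hx
  obtain ⟨m, hm1, hm2⟩ := hy
  have hn' : (2 : ℝ) ≤ n := by exact_mod_cast hn
  have h0 : k + m = 0 := by
    have h1 : ((k + m : ℤ) : ℝ) * n ≤ 0 := by push_cast; linarith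
    have h2 : -2 < ((k + m : ℤ) : ℝ) * n := by push_cast; linarith
    by_contra hne
    rcases lt_or_gt_of_ne hne with hlt | hgt
    · have : ((k + m : ℤ) : ℝ) ≤ -1 := by exact_mod_cast Int.le_sub_one_of_lt hlt
      nlinarith
    · have : (1 : ℝ) ≤ ((k + m : ℤ) : ℝ) := by exact_mod_cast hgt
      nlinarith
  obtain rfl : m = -k := by omega
  rw [pt_eq_pt_iff]
  refine ⟨-k, ?_⟩
  push_cast at *
  linarith

theorem exists_fin_pt_eq (s : ℝ) (k : ℤ) : ∃ m : Fin n, pt n (s + (m : ℕ)) = pt n (s + k) := by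
  have hn0 : (n : ℤ) ≠ 0 := by exact_mod_cast NeZero.ne n
  have h0 := Int.emod_nonneg k hn0
  have h1 := Int.emod_lt_of_pos k (by omega : (0 : ℤ) < n)
  refine ⟨⟨(k % n).toNat, by omega⟩, pt_eq_pt_iff.2 ⟨k / n, ?_⟩⟩
  have hc : (((k % n).toNat : ℕ) : ℝ) = ((k % n : ℤ) : ℝ) := by
    exact_mod_cast congrArg (Int.cast (R := ℝ)) (Int.toNat_of_nonneg h0)
  rw [hc, add_assoc]
  congr 1
  exact_mod_cast (by rw [add_comm, mul_comm]; exact (Int.mul_ediv_add_emod k n).symm)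

theorem mem_segmentPartition_iff {t : Coord n} {A : Set (Coord n)} :
    A ∈ segmentPartition t ↔ ∃ k : ℤ, A = segment (pt n (t + k)) := by
  constructor
  · rintro ⟨k, rfl⟩
    exact ⟨k, by simp [oplus_eq_pt, ofFin]⟩
  · rintro ⟨k, rfl⟩
    obtain ⟨m, hm⟩ := exists_fin_pt_eq (n := n) t k
    exact ⟨m, congrArg segment hm⟩

theorem segment_mem_segmentPartition {t x : Coord n} (h : Int.fract (x : ℝ) = Int.fract (t : ℝ)) :
    segment x ∈ segmentPartition t := by
  obtain ⟨k, hk⟩ := Int.fract_eq_fract.1 h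
  exact mem_segmentPartition_iff.2 ⟨k, by rw [← hk]; simp⟩

theorem fract_eq_of_segment_mem (hn : 2 ≤ n) {t x : Coord n} (h : segment x ∈ segmentPartition t) :
    Int.fract (x : ℝ) = Int.fract (t : ℝ) := by
  obtain ⟨k, hk⟩ := mem_segmentPartition_iff.1 h
  rw [segment_injective hn hk, fract_pt, Int.fract_add_intCast]

theorem eq_of_mem_segment {x y a : Coord n} (h : Int.fract (x : ℝ) = Int.fract (y : ℝ))
    (hx : a ∈ segment x) (hy : a ∈ segment y) : x = y := by
  rw [← pt_coe x, ← pt_coe y, ← pt_coe a] at *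
  rw [pt_mem_segment_pt_iff] at hx hy
  obtain ⟨k, hk1, hk2⟩ := hx
  obtain ⟨m, hm1, hm2⟩ := hy
  simp only [pt_coe] at *
  obtain ⟨j, hj⟩ := Int.fract_eq_fract.1 h
  have h1 : ((j + k * n - m * n : ℤ) : ℝ) < 1 := by push_cast; linarith
  have h2 : -1 < ((j + k * n - m * n : ℤ) : ℝ) := by push_cast; linarith
  have h3 : j + k * n - m * n = 0 := by
    have : j + k * n - m * n < 1 := by exact_mod_cast h1
    have : -1 < j + k * n - m * n := by exact_mod_cast h2
    omega
  have h4 : (j : ℝ) + k * n - m * n = 0 := by exact_mod_cast h3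
  have : pt n (x : ℝ) = pt n (y : ℝ) := pt_eq_pt_iff.2 ⟨k - m, by push_cast; linarith⟩
  simpa using this

theorem exists_mem_segment (t x : Coord n) :
    ∃ k : ℤ, x ∈ segment (pt n (t + k)) := by
  refine ⟨⌊(x : ℝ) - t⌋, ?_⟩
  have h1 := Int.floor_le ((x : ℝ) - t)
  have h2 := Int.lt_floor_add_one ((x : ℝ) - t)
  have := pt_mem_segment_pt_of_le (n := n) (y := x) (z := t + ⌊(x : ℝ) - t⌋) (by linarith)
    (by linarith)
  rwa [pt_coe] at this

theorem isPartition_segmentPartition (t : Coord n) : Setoid.IsPartition (segmentPartition t) := by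
  constructor
  · intro h
    obtain ⟨k, hk⟩ := mem_segmentPartition_iff.1 h
    exact (Set.ext_iff.1 hk _).2 (self_mem_segment _)
  · intro x
    obtain ⟨k, hk⟩ := exists_mem_segment t x
    refine ⟨_, ⟨mem_segmentPartition_iff.2 ⟨k, rfl⟩, hk⟩, ?_⟩
    rintro A ⟨hA, hxA⟩
    obtain ⟨m, rfl⟩ := mem_segmentPartition_iff.1 hA
    congr 1
    refine eq_of_mem_segment ?_ hxA hk
    rw [fract_pt, fract_pt, Int.fract_add_intCast, Int.fract_add_intCast]

theorem pt_add_nat_injective (t : ℝ) {k m : ℕ} (hk : k < n) (hm : m < n)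
    (h : pt n (t + k) = pt n (t + m)) : k = m := by
  obtain ⟨j, hj⟩ := pt_eq_pt_iff.1 h
  have h1 : (m : ℤ) = k + j * n := by
    have : (m : ℝ) = k + j * n := by linarith
    exact_mod_cast this
  have h2 : j = 0 := by
    by_contra hne
    rcases lt_or_gt_of_ne hne with hlt | hgt <;> nlinarith
  subst h2
  omega

theorem ncard_segmentPartition (hn : 2 ≤ n) (t : Coord n) : (segmentPartition t).ncard = n := by
  rw [segmentPartition, ← Set.image_univ, Set.ncard_image_of_injective, Set.ncard_univ,
    Nat.card_fin]
  intro k m h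
  have := segment_injective hn h
  exact Fin.ext (pt_add_nat_injective t k.2 m.2 this)

/-- A non-empty union of parts of `π_s` that is also a union of parts of a different `π_t` is the
whole circle. -/
theorem sUnion_eq_univ_of_ne {s t : Coord n} (hst : Int.fract (s : ℝ) ≠ Int.fract (t : ℝ))
    {𝒜 ℬ : Set (Set (Coord n))} (hA : 𝒜 ⊆ segmentPartition s) (hB : ℬ ⊆ segmentPartition t)
    (hne : 𝒜.Nonempty) (hU : ⋃₀ 𝒜 = ⋃₀ ℬ) : ⋃₀ 𝒜 = Set.univ := by
  have closed : ∀ (u : Coord n) (𝒞 : Set (Set (Coord n))), 𝒞 ⊆ segmentPartition u →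
      ∀ y : ℝ, Int.fract y = Int.fract (u : ℝ) → pt n y ∈ ⋃₀ 𝒞 → segment (pt n y) ⊆ ⋃₀ 𝒞 := by
    rintro u 𝒞 h𝒞 y hy ⟨C, hC, hyC⟩ x hx
    obtain ⟨k, rfl⟩ := mem_segmentPartition_iff.1 (h𝒞 hC)
    refine ⟨_, hC, ?_⟩
    rwa [← eq_of_mem_segment ?_ (self_mem_segment _) hyC]
    rw [fract_pt, fract_pt, Int.fract_add_intCast, hy]
  have step : ∀ m : ℤ, pt n (s + m) ∈ ⋃₀ 𝒜 → pt n (s + (m + 1)) ∈ ⋃₀ 𝒜 := by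
    intro m hm
    have h1 := closed s 𝒜 hA (s + m) (Int.fract_add_intCast _ _) hm
    -- `t + l` is the last start of a part of `π_t` not after `s + m + 1`. As the residues differ,
    -- it lies strictly between `s + m` and `s + m + 1`; so it belongs to the `s`-part already
    -- present, and its own `t`-part contains `s + m + 1`.
    set l : ℤ := ⌊(s : ℝ) + (m + 1) - t⌋ with hl
    have h2 : (t : ℝ) + l ≤ s + (m + 1) := by linarith [Int.floor_le ((s : ℝ) + (m + 1) - t)]
    have h3 : (s : ℝ) + m < t + l := by linarith [Int.lt_floor_add_one ((s : ℝ) + (m + 1) - t)]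
    have h4 : (t : ℝ) + l ≠ s + (m + 1) := fun h => hst (Int.fract_eq_fract.2 ⟨l - (m + 1), by
      push_cast; linarith⟩)
    have h5 := h1 (pt_mem_segment_pt_of_le (n := n) (y := t + l) h3.le
      (by linarith [lt_of_le_of_ne h2 h4]))
    rw [hU] at h5 ⊢
    exact closed t ℬ hB (t + l) (Int.fract_add_intCast _ _) h5
      (pt_mem_segment_pt_of_le h2 (by linarith))
  obtain ⟨A, hA'⟩ := hne
  obtain ⟨k, rfl⟩ := mem_segmentPartition_iff.1 (hA hA')
  have all : ∀ m : ℕ, pt n (s + ((k + m : ℤ) : ℝ)) ∈ ⋃₀ 𝒜 := by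
    intro m
    induction m with
    | zero => exact ⟨_, hA', by simpa using self_mem_segment _⟩
    | succ m ih =>
      have := step _ ih
      convert this using 2
      push_cast
      ring
  rw [Set.eq_univ_iff_forall]
  intro x
  obtain ⟨m, hm⟩ := exists_mem_segment s x
  -- The multiple of `n` makes the number of steps non-negative without changing the class.
  have h0 : 0 ≤ m + (|m| + |k|) * n - k := by
    have hn1 : (1 : ℤ) ≤ n := by exact_mod_cast Nat.one_le_iff_ne_zero.2 (NeZero.ne n)
    nlinarith [neg_abs_le m, le_abs_self k, abs_nonneg m, abs_nonneg k]
  have h1 := all (m + (|m| + |k|) * n - k).toNat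
  rw [Int.toNat_of_nonneg h0] at h1
  refine closed s 𝒜 hA _ (Int.fract_add_intCast _ _) h1 ?_
  convert hm using 2
  rw [pt_eq_pt_iff]
  refine ⟨-(|m| + |k|), ?_⟩
  push_cast
  ring

theorem isNontrivial_segmentPartition (hn : 2 ≤ n) (t : Coord n) :
    BoxSystem.IsNontrivial (segmentPartition t) := by
  intro h
  have := ncard_segmentPartition hn t
  rw [h, Set.ncard_singleton] at this
  omega

theorem sUnion_eq_univ_of_subset_singleton {Y : Type*} {𝒜 : Set (Set Y)} (h : 𝒜 ⊆ {Set.univ})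
    (hne : 𝒜.Nonempty) : ⋃₀ 𝒜 = Set.univ := by
  obtain ⟨A, hA⟩ := hne
  rw [Set.eq_univ_iff_forall]
  intro x
  exact ⟨A, hA, (h hA : A = Set.univ) ▸ trivial⟩

theorem isIndependentSystem (d : ℕ) (hn : 2 ≤ n) :
    BoxSystem.IsIndependentSystem (partitions d n) n where
  isPartition := by
    rintro i π (⟨t, _, rfl⟩ | rfl)
    · exact isPartition_segmentPartition t
    · refine ⟨fun h => ?_, fun a => ⟨Set.univ, ⟨rfl, trivial⟩, fun B hB => hB.1⟩⟩
      exact (Set.ext_iff.1 (show ∅ = Set.univ from h) (pt n 0)).2 trivial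
  ncard_eq := by
    rintro i π (⟨t, _, rfl⟩ | rfl) h
    · exact ncard_segmentPartition hn t
    · exact absurd rfl h
  trivial_mem := fun _ => Or.inr rfl
  sUnion_eq_univ := by
    rintro i π (⟨s, hs, rfl⟩ | rfl) ρ (⟨t, ht, rfl⟩ | rfl) hne 𝒜 hA ℬ hB hAne hU
    · refine sUnion_eq_univ_of_ne (fun h => hne ?_) hA hB hAne hU
      congr 1
      rw [Int.fract_eq_self.2 ⟨s.2.1, hs⟩, Int.fract_eq_self.2 ⟨t.2.1, ht⟩] at h
      exact Subtype.ext h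
    · rw [hU]
      refine sUnion_eq_univ_of_subset_singleton hB ?_
      obtain ⟨A, hA'⟩ := hAne
      obtain ⟨a, ha⟩ : A.Nonempty := by
        obtain ⟨k, rfl⟩ := mem_segmentPartition_iff.1 (hA hA')
        exact ⟨_, self_mem_segment _⟩
      have haU : a ∈ ⋃₀ 𝒜 := ⟨A, hA', ha⟩
      rw [hU] at haU
      obtain ⟨B, hB', -⟩ := haU
      exact ⟨B, hB'⟩
    · exact sUnion_eq_univ_of_subset_singleton hA hAne
    · exact sUnion_eq_univ_of_subset_singleton hA hAne

/-! ### Keller's theorem. -/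

/-- The unit segments of a tiling of the circle agree modulo 1. -/
theorem fract_eq_of_tiling (hn : 2 ≤ n) {J : Type*} {v : J → Coord n}
    (hv : ∀ y, ∃! j, y ∈ segment (v j)) (j j' : J) :
    Int.fract (v j' : ℝ) = Int.fract (v j : ℝ) := by
  have hn' : (2 : ℝ) ≤ n := by exact_mod_cast hn
  have step : ∀ m : ℕ, ∃ i, v i = pt n (v j + m) := by
    intro m
    induction m with
    | zero => exact ⟨j, by simp⟩
    | succ m ih =>
      obtain ⟨i, hi⟩ := ih
      set w : ℝ := v j + m with hw
      obtain ⟨i', hi', -⟩ := hv (pt n (w + 1))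
      refine ⟨i', ?_⟩
      rw [← pt_coe (v i'), pt_mem_segment_pt_iff] at hi'
      obtain ⟨k, hk1, hk2⟩ := hi'
      rcases eq_or_lt_of_le hk1 with he | hlt
      · rw [← pt_coe (v i'), pt_eq_pt_iff]
        refine ⟨k, ?_⟩
        push_cast
        linarith
      · exfalso
        -- A segment covering the right end `w + 1` of `segment (v i)` but starting earlier would
        -- start inside it, hence equal it; as `n ≥ 2`, a segment misses its own right end.
        have h1 : pt n (v i' : ℝ) ∈ segment (v i) := by
          rw [hi, pt_mem_segment_pt_iff]
          exact ⟨-k, by push_cast; linarith, by push_cast; linarith⟩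
        rw [pt_coe] at h1
        have h2 : i = i' := (hv (v i')).unique h1 (self_mem_segment _)
        rw [← h2, hi] at hk1 hk2 hlt
        obtain ⟨l, hl⟩ := exists_coe_pt (n := n) w
        rw [hl] at hlt hk2
        have h3 : ((l + k : ℤ) : ℝ) * n < 1 := by push_cast; linarith
        have h4 : 0 < ((l + k : ℤ) : ℝ) * n := by push_cast; linarith
        have h5 : 0 < l + k := by
          have := pos_of_mul_pos_left h4 (natCast_pos_real n).le
          exact_mod_cast this
        have h6 : (1 : ℝ) ≤ ((l + k : ℤ) : ℝ) := by exact_mod_cast h5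
        nlinarith
  -- The summand `n` makes the number of steps non-negative; the winding `-1` below undoes it.
  have h0 : 0 ≤ ⌊(v j' : ℝ) - v j + n⌋ :=
    Int.floor_nonneg.2 (by linarith [(v j').2.1, (v j).2.2])
  obtain ⟨i, hi⟩ := step ⌊(v j' : ℝ) - v j + n⌋.toNat
  have hc : ((⌊(v j' : ℝ) - v j + n⌋.toNat : ℕ) : ℝ) = ((⌊(v j' : ℝ) - v j + n⌋ : ℤ) : ℝ) := by
    exact_mod_cast congrArg (Int.cast (R := ℝ)) (Int.toNat_of_nonneg h0)
  have h1 : pt n (v j' : ℝ) ∈ segment (v i) := by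
    rw [hi, pt_mem_segment_pt_iff, hc]
    have h1 := Int.floor_le ((v j' : ℝ) - v j + n)
    have h2 := Int.lt_floor_add_one ((v j' : ℝ) - v j + n)
    exact ⟨-1, by push_cast; linarith, by push_cast; linarith⟩
  rw [pt_coe] at h1
  rw [← (hv (v j')).unique h1 (self_mem_segment _), hi, fract_pt, Int.fract_add_natCast]

theorem mem_segment_pt_add (x u : Coord n) (c : ℝ) :
    x ∈ segment (pt n (u + c)) ↔ pt n (x - c) ∈ segment u := by
  rw [← pt_coe x, ← pt_coe u, pt_mem_segment_pt_iff, pt_mem_segment_pt_iff]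
  simp only [pt_coe]
  exact exists_congr fun k => ⟨fun h => ⟨by linarith, by linarith⟩,
    fun h => ⟨by linarith, by linarith⟩⟩

open Classical in
/-- Translate the points congruent to `a` modulo 1 by `c`. -/
noncomputable def shift (a c : ℝ) (u : Coord n) : Coord n :=
  if Int.fract (u : ℝ) = a then pt n (u + c) else u

/-- By `fract_eq_of_tiling` either all segments are moved by `c` or none is. -/
theorem existsUnique_shift (hn : 2 ≤ n) {J : Type*} {v : J → Coord n}
    (hv : ∀ y, ∃! j, y ∈ segment (v j)) (a c : ℝ) (y : Coord n) :
    ∃! j, y ∈ segment (shift a c (v j)) := by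
  obtain ⟨j₀, -, -⟩ := hv y
  have h := fract_eq_of_tiling hn hv j₀
  by_cases ha : Int.fract (v j₀ : ℝ) = a
  · simp only [shift, h, ha, if_true, mem_segment_pt_add]
    exact hv _
  · simp only [shift, h, ha, if_false]
    exact hv y

/-- On each line in direction `i` the cubes cut out a tiling of a circle, so the one-dimensional
case applies line by line. -/
theorem existsUnique_update_shift (hn : 2 ≤ n) {J ι : Type*} [DecidableEq ι]
    {τ : J → ι → Coord n} (hτ : ∀ x : ι → Coord n, ∃! j, ∀ i, x i ∈ segment (τ j i)) (i : ι)
    (a c : ℝ) (x : ι → Coord n) :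
    ∃! j, ∀ k, x k ∈ segment (Function.update (τ j) i (shift a c (τ j i)) k) := by
  have hsplit : ∀ (x : ι → Coord n) (w : ι → Coord n) (b : Coord n),
      (∀ k, x k ∈ segment (Function.update w i b k)) ↔
        (∀ k, k ≠ i → x k ∈ segment (w k)) ∧ x i ∈ segment b := by
    intro x w b
    constructor
    · exact fun h => ⟨fun k hk => by simpa [hk] using h k, by simpa using h i⟩
    · rintro ⟨h1, h2⟩ k
      by_cases hk : k = i
      · subst hk; simpa
      · simpa [hk] using h1 k hk
  let v : {j // ∀ k, k ≠ i → x k ∈ segment (τ j k)} → Coord n := fun j => τ j i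
  have hv : ∀ y, ∃! j, y ∈ segment (v j) := by
    intro y
    obtain ⟨j, hj, huniq⟩ := hτ (Function.update x i y)
    refine ⟨⟨j, fun k hk => by simpa [hk] using hj k⟩, by simpa using hj i, ?_⟩
    rintro ⟨j', hj'⟩ hy
    refine Subtype.ext (huniq j' fun k => ?_)
    by_cases hk : k = i
    · subst hk; simpa using hy
    · simpa [hk] using hj' k hk
  obtain ⟨⟨j, hj⟩, hjx, huniq⟩ := existsUnique_shift hn hv a c (x i)
  refine ⟨j, (hsplit _ _ _).2 ⟨hj, hjx⟩, fun j' hj' => ?_⟩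
  obtain ⟨h1, h2⟩ := (hsplit _ _ _).1 hj'
  exact congrArg Subtype.val (huniq ⟨j', h1⟩ h2)

/-- Keller's theorem: two cubes of a tiling differ by a non-zero integer in some direction. -/
theorem exists_fract_eq_and_ne (hn : 2 ≤ n) {J ι : Type*} [Fintype ι] {τ : J → ι → Coord n}
    (hτ : ∀ x : ι → Coord n, ∃! j, ∀ i, x i ∈ segment (τ j i)) {s t : J} (hst : s ≠ t) :
    ∃ i, Int.fract (τ s i : ℝ) = Int.fract (τ t i : ℝ) ∧ τ s i ≠ τ t i := by
  classical
  by_contra! hcon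
  -- In each direction the residue class of `τ s i` is moved so that `τ s i` goes to `τ t i`. By
  -- `hcon` this fixes `τ t i`. All shifts together give a tiling in which the indices `s` and `t`
  -- name the same cube, which uniqueness of the index forbids.
  let r : ι → Coord n → Coord n := fun i =>
    shift (Int.fract (τ s i : ℝ)) ((τ t i : ℝ) - τ s i)
  have key : ∀ F : Finset ι, ∀ x : ι → Coord n,
      ∃! j, ∀ i, x i ∈ segment (if i ∈ F then r i (τ j i) else τ j i) := by
    intro F
    induction F using Finset.induction_on with
    | empty => simpa using hτ
    | insert a F ha ih =>
      intro x
      have := existsUnique_update_shift hn ih a (Int.fract (τ s a : ℝ))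
        ((τ t a : ℝ) - τ s a) x
      convert this using 6 with j i
      by_cases hi : i = a
      · subst hi
        simp [ha, r]
      · simp [hi]
  have hs : ∀ i, r i (τ s i) = τ t i := fun i => by simp [r, shift]
  have ht : ∀ i, r i (τ t i) = τ t i := by
    intro i
    by_cases h : Int.fract (τ s i : ℝ) = Int.fract (τ t i : ℝ)
    · simp [r, shift, hcon i h]
    · simp [r, shift, Ne.symm h]
  refine hst ((key Finset.univ (τ t)).unique (fun i => ?_) fun i => ?_)
  · simpa [hs] using self_mem_segment _
  · simpa [ht] using self_mem_segment _

end

/-! ### Cube tilings as Keller families. -/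

section

variable {d n : ℕ} [NeZero n] {T : Set (Torus d n)}

theorem mem_cube_iff {d n : ℕ} {t x : Torus d n} : x ∈ cube t ↔ ∀ i, x i ∈ segment (t i) := by
  rw [← pi_cubeSides]
  simp [cubeSides]

theorem cubeSides_injective (hn : 2 ≤ n) : Function.Injective (cubeSides (d := d) (n := n)) :=
  fun _ _ h => funext fun i => segment_injective hn (congrFun h i)

theorem cube_injective (hn : 2 ≤ n) : Function.Injective (cube (d := d) (n := n)) := by
  intro s t h
  rw [← pi_cubeSides, ← pi_cubeSides] at h
  have hne : ∀ u : Torus d n, ¬ ∃ i, cubeSides u i = ∅ := by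
    rintro u ⟨i, hi⟩
    exact (Set.ext_iff.1 hi (u i)).1 (self_mem_segment (u i))
  have hsub : ∀ u v : Torus d n, Set.univ.pi (cubeSides u) ⊆ Set.univ.pi (cubeSides v) →
      ∀ i, cubeSides u i ⊆ cubeSides v i := fun u v huv =>
    (Set.univ_pi_subset_univ_pi_iff.1 huv).resolve_right (hne u)
  exact cubeSides_injective hn (funext fun i => (hsub s t h.subset i).antisymm
    (hsub t s h.symm.subset i))

theorem IsCubeTiling.existsUnique (hn : 2 ≤ n) (hT : IsCubeTiling T) (x : Torus d n) :
    ∃! t : T, ∀ i, x i ∈ segment ((t : Torus d n) i) := by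
  obtain ⟨C, ⟨⟨t, ht, rfl⟩, hx⟩, huniq⟩ := hT.2 x
  refine ⟨⟨t, ht⟩, mem_cube_iff.1 hx, ?_⟩
  rintro ⟨s, hs⟩ hxs
  exact Subtype.ext (cube_injective hn (huniq (cube s) ⟨⟨s, hs, rfl⟩, mem_cube_iff.2 hxs⟩))

/-- The integer is `⌈t⌉` modulo `n`. -/
theorem existsUnique_ofFin_mem_segment (t : Coord n) : ∃! k : Fin n, ofFin k ∈ segment t := by
  have hk : ∀ k : Fin n, ofFin k = pt n (0 + (k : ℕ)) := fun k => by
    rw [zero_add]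
    exact (pt_coe (ofFin k)).symm
  obtain ⟨k, hk'⟩ := exists_fin_pt_eq (n := n) 0 ⌈(t : ℝ)⌉
  refine ⟨k, ?_, fun m hm => ?_⟩
  · have := pt_mem_segment_pt_of_le (n := n) (Int.le_ceil (t : ℝ)) (Int.ceil_lt_add_one (t : ℝ))
    rwa [pt_coe, ← zero_add (⌈(t : ℝ)⌉ : ℝ), ← hk', ← hk] at this
  · change ofFin m ∈ segment t at hm
    rw [hk, ← pt_coe t, pt_mem_segment_pt_iff] at hm
    obtain ⟨j, h1, h2⟩ := hm
    have h3 : ⌈(t : ℝ)⌉ = m - j * n := by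
      rw [Int.ceil_eq_iff]
      push_cast
      constructor <;> linarith
    refine Fin.ext (pt_add_nat_injective 0 m.2 k.2 ?_)
    rw [hk', h3, pt_eq_pt_iff]
    exact ⟨-j, by push_cast; ring⟩

/-- Each cube contains exactly one of the `n ^ d` integer points, and each such point lies in
exactly one cube. -/
theorem IsCubeTiling.ncard_eq (hn : 2 ≤ n) (hT : IsCubeTiling T) : T.ncard = n ^ d := by
  choose f hf hf' using hT.existsUnique hn
  choose k hk hk' using existsUnique_ofFin_mem_segment (n := n)
  have hbij : Function.Bijective fun g : Fin d → Fin n => f fun i => ofFin (g i) := by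
    constructor
    · intro g g' h
      change f _ = f _ at h
      funext i
      have h1 := hf (fun i => ofFin (g i)) i
      have h2 := hf (fun i => ofFin (g' i)) i
      rw [← h] at h2
      exact (hk' _ _ h1).trans (hk' _ _ h2).symm
    · intro t
      exact ⟨fun i => k ((t : Torus d n) i), (hf' _ t fun i => hk _).symm⟩
  rw [← Nat.card_coe_set_eq, ← Nat.card_congr (Equiv.ofBijective _ hbij)]
  simp

theorem IsCubeTiling.finite (hn : 2 ≤ n) (hT : IsCubeTiling T) : T.Finite :=
  Set.finite_of_ncard_pos (by rw [hT.ncard_eq hn]; positivity)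

theorem segmentPartition_mem_partitions (i : Fin d) (t : Coord n) :
    segmentPartition (pt n (Int.fract (t : ℝ))) ∈ partitions d n i := by
  have h1 : (1 : ℝ) ≤ n := by exact_mod_cast Nat.one_le_iff_ne_zero.2 (NeZero.ne n)
  have hu : Int.fract (t : ℝ) ∈ Set.Ico (0 : ℝ) n :=
    ⟨Int.fract_nonneg _, (Int.fract_lt_one _).trans_le h1⟩
  have := pt_coe (⟨Int.fract (t : ℝ), hu⟩ : Coord n)
  exact Or.inl ⟨⟨Int.fract (t : ℝ), hu⟩, Int.fract_lt_one (t : ℝ),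
    congrArg segmentPartition this.symm⟩

theorem segment_mem_segmentPartition_fract (t : Coord n) :
    segment t ∈ segmentPartition (pt n (Int.fract (t : ℝ))) :=
  segment_mem_segmentPartition (by rw [fract_pt, Int.fract_fract])

theorem IsCubeTiling.isKellerFamily (hn : 2 ≤ n) (hT : IsCubeTiling T) :
    BoxSystem.IsKellerFamily (partitions d n) (cubeFamily T) := by
  refine ⟨?_, ?_, ?_⟩
  · obtain ⟨t, -, -⟩ := hT.existsUnique hn fun _ => pt n 0
    exact ⟨_, t, t.2, rfl⟩
  · rintro _ ⟨t, -, rfl⟩ i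
    exact ⟨_, segmentPartition_mem_partitions i (t i), segment_mem_segmentPartition_fract (t i)⟩
  · rintro _ ⟨s, hs, rfl⟩ _ ⟨t, ht, rfl⟩ hst
    obtain ⟨i, h1, h2⟩ := exists_fract_eq_and_ne hn (hT.existsUnique hn) (s := ⟨s, hs⟩)
      (t := ⟨t, ht⟩) (fun h => hst (by rw [Subtype.mk.inj h]))
    refine ⟨i, _, segmentPartition_mem_partitions i (s i), segment_mem_segmentPartition_fract _, ?_,
      fun h => h2 (segment_injective hn h)⟩
    exact segment_mem_segmentPartition (by rw [fract_pt, Int.fract_fract]; exact h1.symm)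

theorem IsCubeTiling.mem_union_cubeFamily {d n : ℕ} {T : Set (Torus d n)}
    (hT : IsCubeTiling T) (x : Torus d n) :
    x ∈ BoxSystem.union (cubeFamily T) := by
  obtain ⟨_, ⟨t, ht, rfl⟩, hx⟩ := (hT.2 x).exists
  exact BoxSystem.mem_union.2 ⟨_, ⟨t, ht, rfl⟩, mem_cube_iff.1 hx⟩

/-- The union is the whole torus, so the condition on lines is void and every partition that occurs
is hidden. -/
theorem IsCubeTiling.hidden_eq (hn : 2 ≤ n) (hT : IsCubeTiling T) (i : Fin d) :
    BoxSystem.hidden (partitions d n) i (cubeFamily T) =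
      (fun r => segmentPartition (pt n r)) '' residues i T := by
  ext π
  rw [(isIndependentSystem d hn).mem_hidden_iff (hT.isKellerFamily hn)]
  constructor
  · rintro ⟨hπ, hπn, ⟨_, ⟨t, ht, rfl⟩, htπ⟩, -⟩
    refine ⟨_, ⟨t, ht, rfl⟩, ?_⟩
    exact (isIndependentSystem d hn).partition_eq hπ hπn (segmentPartition_mem_partitions i (t i))
      htπ (segment_mem_segmentPartition_fract (t i))
  · rintro ⟨_, ⟨t, ht, rfl⟩, rfl⟩
    exact ⟨segmentPartition_mem_partitions i (t i), isNontrivial_segmentPartition hn _,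
      ⟨_, ⟨t, ht, rfl⟩, segment_mem_segmentPartition_fract (t i)⟩, fun _ _ _ x _ =>
      hT.mem_union_cubeFamily x⟩

theorem ncard_image_residues (hn : 2 ≤ n) (i : Fin d) :
    ((fun r => segmentPartition (pt n r)) '' residues i T).ncard = (residues i T).ncard := by
  refine Set.InjOn.ncard_image ?_
  rintro _ ⟨s, hs, rfl⟩ _ ⟨t, ht, rfl⟩ h
  have h1 := segment_mem_segmentPartition_fract (s i)
  rw [show segmentPartition _ = segmentPartition _ from h] at h1
  have h2 := fract_eq_of_segment_mem hn h1
  rwa [fract_pt, Int.fract_fract] at h2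

theorem ncard_hiddenPairs {ι : Type*} [Fintype ι] {X : ι → Type*}
    {P : ∀ i, Set (Set (Set (X i)))} {G : Set (∀ i, Set (X i))}
    (hf : ∀ i, (BoxSystem.hidden P i G).Finite) :
    (BoxSystem.hiddenPairs P G).ncard = ∑ i, (BoxSystem.hidden P i G).ncard := by
  classical
  have : BoxSystem.hiddenPairs P G =
      ((Finset.univ.sigma fun i => (hf i).toFinset : Finset _) : Set _) := by
    ext
    simp [BoxSystem.hiddenPairs]
  rw [this, Set.ncard_coe_finset, Finset.card_sigma]
  exact Finset.sum_congr rfl fun i _ => (Set.ncard_eq_toFinset_card _ _).symm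

end

end CubeTiling

/-! ### The theorem for cube tilings. -/

theorem mainTheorem2 (d n : ℕ) (hn : 2 ≤ n) (T : Set (CubeTiling.Torus d n))
    (hT : CubeTiling.IsCubeTiling T) :
    (∀ i, (CubeTiling.residues i T).Finite) ∧
    (∑ i, ((CubeTiling.residues i T).ncard : ℝ)) ≤ ((n : ℝ) ^ d - 1) / ((n : ℝ) - 1) ∧
    ((∑ i, ((CubeTiling.residues i T).ncard : ℝ)) = ((n : ℝ) ^ d - 1) / ((n : ℝ) - 1) ↔
      BoxSystem.IsMultipile (CubeTiling.partitions d n) (CubeTiling.cubeFamily T)) := by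
  have : NeZero n := ⟨by omega⟩
  have hP := CubeTiling.isIndependentSystem d hn
  have hG := hT.isKellerFamily hn
  have hres : ∀ i, (CubeTiling.residues i T).Finite := fun i => (hT.finite hn).image _
  have hfin : (CubeTiling.cubeFamily T).Finite := (hT.finite hn).image _
  have hcard : (CubeTiling.cubeFamily T).ncard = n ^ d := by
    rw [CubeTiling.cubeFamily, Set.ncard_image_of_injective _ (CubeTiling.cubeSides_injective hn),
      hT.ncard_eq hn]
  have hsum : (BoxSystem.hiddenPairs (CubeTiling.partitions d n) (CubeTiling.cubeFamily T)).ncard =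
      ∑ i, (CubeTiling.residues i T).ncard := by
    rw [CubeTiling.ncard_hiddenPairs fun i => by
      rw [hT.hidden_eq hn]; exact (hres i).image _]
    exact Finset.sum_congr rfl fun i _ => by
      rw [hT.hidden_eq hn, CubeTiling.ncard_image_residues hn]
  have hle := hP.ncard_hiddenPairs_le hn hG hfin
  have htight : BoxSystem.IsTight (CubeTiling.partitions d n) n (CubeTiling.cubeFamily T) ↔
      BoxSystem.IsMultipile (CubeTiling.partitions d n) (CubeTiling.cubeFamily T) :=
    ⟨fun h => h.isMultipile hP hn hG hfin, fun h => h.isTight hP hn hfin⟩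
  rw [BoxSystem.IsTight, hsum, hcard] at htight
  rw [hsum, hcard] at hle
  have hn1 : (0 : ℝ) < n - 1 := by
    have : (2 : ℝ) ≤ n := by exact_mod_cast hn
    linarith
  rw [← Nat.cast_sum, le_div_iff₀ hn1, eq_div_iff hn1.ne', ← htight]
  -- This removes the truncated subtraction before passing to the reals.
  obtain ⟨m, rfl⟩ : ∃ m, n = m + 1 := ⟨n - 1, by omega⟩
  rw [Nat.add_sub_cancel] at hle ⊢
  refine ⟨hres, ?_, ?_⟩
  · have : (m * ∑ i, (CubeTiling.residues i T).ncard + 1 : ℝ) ≤ ((m + 1 : ℕ) : ℝ) ^ d := by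
      exact_mod_cast hle
    push_cast at this ⊢
    linarith
  · rw [← Nat.cast_inj (R := ℝ)]
    push_cast
    constructor <;> intro h <;> linarith
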